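/- Let $R=(R^{\lambda\alpha}_{\beta\mu})$, $\lambda,\alpha,\beta,\mu\in\{0,1,2,3\}$, be complex numbers and let $\mathcal A_R$ be the complex unital $*$-algebra generated by hermitian elements $x_1^\lambda,x_2^\alpha$ with relations $x_1^\lambda x_1^\mu=x_1^\mu x_1^\lambda$, $x_2^\alpha x_2^\beta=x_2^\beta x_2^\alpha$, $x_1^\lambda x_2^\alpha=\sum_{\beta,\mu} R^{\lambda\alpha}_{\beta\mu}x_2^\beta x_1^\mu$, $x_2^\alpha x_1^\lambda=\sum_{\beta,\mu}\overline{R}{}^{\lambda\alpha}_{\beta\mu}x_1^\mu x_2^\beta$. Write these relations together as $x^ax^b=\sum_{c,d}\mathcal R^{ab}_{cd}x^cx^d$, where $\mathcal R$ is the flip on the commuting pairs. Assume that $\sum_{\beta,\mu}\overline{R}{}^{\lambda\alpha}_{\beta\mu}R^{\mu\beta}_{\gamma\nu}=\delta^\lambda_\nu\delta^\alpha_\gamma$, that $\mathcal R$ satisfies the Yang--Baxter equation $(\mathcal R\otimes I)(I\otimes\mathcal R)(\mathcal R\otimes I)=(I\otimes\mathcal R)(\mathcal R\otimes I)(I\otimes\mathcal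 R)$, and that $(x_1)^2=\sum_\lambda(x_1^\lambda)^2$ and $(x_2)^2=\sum_\alpha(x_2^\alpha)^2$ are central in $\mathcal A_R$. Put $\mathcal A(S^7_R)=\mathcal A_R/((x_1)^2+(x_2)^2-1)$. Let $e_0=1$ and $e_1,e_2,e_3$ be the quaternion units in $M_2(\mathbb C)$ ($e_k=-\mathrm i\sigma_k$), $x_i=\sum_\mu x_i^\mu e_\mu$, $|\psi\rangle=\binom{x_2}{x_1}$, and define $Y=\sum_{\mu=0}^3Y^\mu e_\mu$ and $Y^4$ by $\tfrac12Y=x_2x_1^*$ and $Y^4=(x_2)^2-(x_1)^2$. Let $\mathcal A(S^4_R)\subset\mathcal A(S^7_R)$ be the $*$-subalgebra generated by $Y^0,\dots,Y^4$, and $\mathcal A(S^3_R)=\mathcal A(S^4_R)/(Y^4)$. For a unital algebra $\mathcal A$ put $\widetilde{\mathcal A}=\mathcal A/\mathbb C1$; let $b$ be the Hochschild boundary on the normalized chains $\mathcal A\otimes\widetilde{\mathcal A}^{\otimes n}$ and $\langle\,\cdot\,\rangle$ the matrix trace. For an idempotent matrix $e$ over $\mathcal A$ let $\mathrm{ch}_k(e)=\langle(e-\tfrac12)\otimes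 e^{\otimes2k}\rangle\in\mathcal A\otimes\widetilde{\mathcal A}^{\otimes 2k}$. For a square matrix $U$ over a $*$-algebra $\mathcal A$ let $\mathrm{ch}_{k+\frac12}(U)=\langle(U\otimes U^*)^{\otimes(k+1)}-(U^*\otimes U)^{\otimes(k+1)}\rangle\in\mathcal A\otimes\widetilde{\mathcal A}^{\otimes(2k+1)}$. Then: (i) $\langle\psi|\psi\rangle=1$, and $p=|\psi\rangle\langle\psi|=\frac12\begin{pmatrix}1+Y^4&Y\\Y^*&1-Y^4\end{pmatrix}$ satisfies $p=p^*=p^2$ over $\mathcal A(S^4_R)$; over $\mathcal A(S^3_R)$ one has $YY^*=Y^*Y=1$. (ii) $\mathrm{ch}_0(p)=0$. (iii) If $\mathrm{ch}_{\frac12}(Y)=0$ over $\mathcal A(S^4_R)$, then $\mathrm{ch}_1(p)=0$ and $b\,\mathrm{ch}_2(p)=0$, and $b\,\mathrm{ch}_{\frac32}(Y)=0$ over $\mathcal A(S^3_R)$. (iv) If moreover the action $|\psi\rangle\mapsto|\psi\rangle w$, $w\in SU(2)$, on the generators is by $*$-automorphisms of $\mathcal A(S^7_R)$, then $\mathrm{ch}_2(p)$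 over $\mathcal A(S^4_R)$ and $\mathrm{ch}_{\frac32}(Y)$ over $\mathcal A(S^3_R)$ are nonzero. Hence they are nonzero Hochschild cycles (the volume forms), and all lower components $\mathrm{ch}_0(p),\mathrm{ch}_1(p)$, respectively $\mathrm{ch}_{\frac12}(Y)$, vanish; that is, $S^4_R$ and $S^3_R$ are noncommutative spherical manifolds. -/

import Mathlib

namespace NCSpheres

universe u v

noncomputable section

open scoped TensorProduct

/-! ### The free `*`-algebra on hermitian generators -/

/-- The free complex algebra on `X`, carrying the complex conjugate scalar multiplication. -/
def ConjFreeAlgebra (X : Type u) : Type u := FreeAlgebra ℂ X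

instance (X : Type u) : Ring (ConjFreeAlgebra X) := inferInstanceAs (Ring (FreeAlgebra ℂ X))

instance (X : Type u) : Algebra ℂ (ConjFreeAlgebra X) :=
  ((algebraMap ℂ (FreeAlgebra ℂ X)).comp (starRingEnd ℂ)).toAlgebra'
    (fun c x => Algebra.commutes (R := ℂ) (A := FreeAlgebra ℂ X) ((starRingEnd ℂ) c) x)

/-- Complex conjugation of the coefficients of a noncommutative polynomial. -/
def conjCoeff (X : Type u) : FreeAlgebra ℂ X →+* FreeAlgebra ℂ X :=
  (FreeAlgebra.lift ℂ (A := ConjFreeAlgebra X) (FreeAlgebra.ι ℂ)).toRingHom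

theorem conjCoeff_ι {X : Type u} (x : X) :
    conjCoeff X (FreeAlgebra.ι ℂ x) = FreeAlgebra.ι ℂ x :=
  FreeAlgebra.lift_ι_apply (A := ConjFreeAlgebra X) (FreeAlgebra.ι ℂ) x

theorem conjCoeff_algebraMap {X : Type u} (c : ℂ) :
    conjCoeff X (algebraMap ℂ (FreeAlgebra ℂ X) c) = algebraMap ℂ (FreeAlgebra ℂ X) (star c) :=
  AlgHom.commutes (FreeAlgebra.lift ℂ (A := ConjFreeAlgebra X) (FreeAlgebra.ι ℂ)) c

theorem conjCoeff_conjCoeff {X : Type u} (a : FreeAlgebra ℂ X) :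
    conjCoeff X (conjCoeff X a) = a := by
  induction a using FreeAlgebra.induction with
  | grade0 c => simp [conjCoeff_algebraMap]
  | grade1 x => simp [conjCoeff_ι]
  | mul a b ha hb => rw [map_mul, map_mul, ha, hb]
  | add a b ha hb => rw [map_add, map_add, ha, hb]

theorem conjCoeff_star {X : Type u} (a : FreeAlgebra ℂ X) :
    conjCoeff X (star a) = star (conjCoeff X a) := by
  induction a using FreeAlgebra.induction with
  | grade0 c => simp [conjCoeff_algebraMap]
  | grade1 x => simp [conjCoeff_ι]
  | mul a b ha hb => rw [star_mul, map_mul, map_mul, star_mul, ha, hb]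
  | add a b ha hb => rw [star_add, map_add, map_add, star_add, ha, hb]

theorem conjStar_conjStar {X : Type u} (a : FreeAlgebra ℂ X) :
    star (conjCoeff X (star (conjCoeff X a))) = a := by
  rw [conjCoeff_star, star_star, conjCoeff_conjCoeff]

theorem conjStar_mul {X : Type u} (a b : FreeAlgebra ℂ X) :
    star (conjCoeff X (a * b)) = star (conjCoeff X b) * star (conjCoeff X a) := by
  rw [map_mul, star_mul]

theorem conjStar_add {X : Type u} (a b : FreeAlgebra ℂ X) :
    star (conjCoeff X (a + b)) = star (conjCoeff X a) + star (conjCoeff X b) := by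
  rw [map_add, star_add]

/-- The free complex `*`-algebra on a family of hermitian generators. -/
def FreeStarAlgebra (X : Type u) : Type u := FreeAlgebra ℂ X

namespace FreeStarAlgebra

variable {X : Type u}

instance : Ring (FreeStarAlgebra X) := inferInstanceAs (Ring (FreeAlgebra ℂ X))

instance : Algebra ℂ (FreeStarAlgebra X) := inferInstanceAs (Algebra ℂ (FreeAlgebra ℂ X))

/-- The hermitian generators. -/
def gen (x : X) : FreeStarAlgebra X := FreeAlgebra.ι ℂ x

instance : StarRing (FreeStarAlgebra X) where
  star a := (star (conjCoeff X a) : FreeAlgebra ℂ X)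
  star_involutive a := conjStar_conjStar (X := X) a
  star_mul a b := conjStar_mul (X := X) a b
  star_add a b := conjStar_add (X := X) a b

theorem star_gen (x : X) : star (gen x) = gen x := by
  change star (conjCoeff X (FreeAlgebra.ι ℂ x)) = FreeAlgebra.ι ℂ x
  rw [conjCoeff_ι, FreeAlgebra.star_ι]

theorem star_algebraMap (c : ℂ) :
    star (algebraMap ℂ (FreeStarAlgebra X) c) = algebraMap ℂ (FreeStarAlgebra X) (star c) := by
  change star (conjCoeff X (algebraMap ℂ (FreeAlgebra ℂ X) c)) =
    algebraMap ℂ (FreeAlgebra ℂ X) (star c)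
  rw [conjCoeff_algebraMap, FreeAlgebra.star_algebraMap]

instance : StarModule ℂ (FreeStarAlgebra X) where
  star_smul c a := by
    rw [Algebra.smul_def, star_mul, star_algebraMap, Algebra.smul_def, Algebra.commutes]

end FreeStarAlgebra

theorem star_mkAlgHom {B : Type u} [Ring B] [Algebra ℂ B] [StarRing B] (r : B → B → Prop)
    (hr : ∀ a b, r a b → r (star a) (star b)) (x : B) :
    (RingQuot.starRing r hr).star (RingQuot.mkAlgHom ℂ r x) = RingQuot.mkAlgHom ℂ r (star x) := by
  simp only [RingQuot.mkAlgHom_def, RingQuot.mkRingHom_def]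
  rfl

theorem starModule_ringQuot {B : Type u} [Ring B] [Algebra ℂ B] [StarRing B] [StarModule ℂ B]
    (r : B → B → Prop) (hr : ∀ a b, r a b → r (star a) (star b)) :
    letI := RingQuot.starRing r hr;
    StarModule ℂ (RingQuot r) := by
  let _ := RingQuot.starRing r hr
  refine ⟨fun c a => ?_⟩
  obtain ⟨x, rfl⟩ := RingQuot.mkAlgHom_surjective ℂ r a
  rw [← map_smul, star_mkAlgHom r hr, star_mkAlgHom r hr, star_smul, map_smul]

/-! ### Normalized Hochschild chains and Chern characters -/

namespace Hochschild

/-- Hochschild `n`-chains `A ⊗ A^{⊗ n}`. -/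
abbrev Chain (A : Type u) [Ring A] [Algebra ℂ A] (n : ℕ) : Type u := ⨂[ℂ] _ : Fin (n + 1), A

variable {A : Type u} [Ring A]

/-- The `i`-th face of `(a₀, …, aₙ₊₁)`: the entries `aᵢ` and `aᵢ₊₁` are multiplied, and for
`i = n + 1` the result is `(aₙ₊₁ a₀, a₁, …, aₙ)`. -/
def face {n : ℕ} (i : Fin (n + 2)) (a : Fin (n + 2) → A) : Fin (n + 1) → A :=
  if i = Fin.last (n + 1) then fun k => if k = 0 then a (Fin.last (n + 1)) * a 0 else a k.castSucc
  else i.contractNth (· * ·) a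

theorem face_zero_last {n : ℕ} (a : Fin (n + 2) → A) :
    face (Fin.last (n + 1)) a 0 = a (Fin.last (n + 1)) * a 0 := by
  simp only [face, if_true]

theorem face_of_lt {n : ℕ} (i : Fin (n + 2)) (a : Fin (n + 2) → A) (k : Fin (n + 1))
    (h : (k : ℕ) < i) (h' : i ≠ Fin.last (n + 1) ∨ k ≠ 0) : face i a k = a k.castSucc := by
  by_cases hi : i = Fin.last (n + 1)
  · have hk : k ≠ 0 := h'.resolve_left (fun h => h hi)
    simp only [face, hi, hk, if_true, if_false]
  · simp only [face, hi, if_false, Fin.contractNth, h, if_true]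

theorem face_of_eq {n : ℕ} (i : Fin (n + 2)) (a : Fin (n + 2) → A) (k : Fin (n + 1))
    (h : (k : ℕ) = i) : face i a k = a k.castSucc * a k.succ := by
  have hi : i ≠ Fin.last (n + 1) := by
    rintro rfl
    have := k.2
    simp only [Fin.val_last] at h
    omega
  simp only [face, hi, if_false, Fin.contractNth, h, lt_irrefl, if_true]

theorem face_of_gt {n : ℕ} (i : Fin (n + 2)) (a : Fin (n + 2) → A) (k : Fin (n + 1))
    (h : (i : ℕ) < k) : face i a k = a k.succ := by
  have hi : i ≠ Fin.last (n + 1) := by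
    rintro rfl
    have := k.2
    simp only [Fin.val_last] at h
    omega
  have h1 : ¬ (k : ℕ) < i := by omega
  have h2 : ¬ (k : ℕ) = i := by omega
  simp only [face, hi, if_false, Fin.contractNth, h1, h2]

variable [Algebra ℂ A]

theorem face_update {n : ℕ} (i : Fin (n + 2)) (a : Fin (n + 2) → A) (j : Fin (n + 2)) :
    ∃ (k : Fin (n + 1)) (l : A →ₗ[ℂ] A), ∀ x : A,
      face i (Function.update a j x) = Function.update (face i a) k (l x) := by
  by_cases hi : i = Fin.last (n + 1)
  · subst hi
    by_cases hj : j = Fin.last (n + 1)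
    · subst hj
      refine ⟨0, LinearMap.mulRight ℂ (a 0), fun x => ?_⟩
      funext k
      by_cases hk : k = 0
      · subst hk
        have h0 : (0 : Fin (n + 2)) ≠ Fin.last (n + 1) := fun h => by
          have := congrArg Fin.val h
          simp at this
        rw [face_zero_last, Function.update_self, Function.update_self,
          Function.update_of_ne h0, LinearMap.mulRight_apply]
      · have hl : k.castSucc ≠ Fin.last (n + 1) := Fin.castSucc_ne_last k
        rw [Function.update_of_ne hk, face_of_lt _ _ _ k.2 (Or.inr hk),
          face_of_lt _ _ _ k.2 (Or.inr hk), Function.update_of_ne hl]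
    · by_cases hj0 : j = 0
      · subst hj0
        refine ⟨0, LinearMap.mulLeft ℂ (a (Fin.last (n + 1))), fun x => ?_⟩
        funext k
        by_cases hk : k = 0
        · subst hk
          rw [face_zero_last, Function.update_self, Function.update_self,
            Function.update_of_ne (Ne.symm hj), LinearMap.mulLeft_apply]
        · have h0 : k.castSucc ≠ 0 := fun h => hk (Fin.castSucc_eq_zero_iff.1 h)
          rw [Function.update_of_ne hk, face_of_lt _ _ _ k.2 (Or.inr hk),
            face_of_lt _ _ _ k.2 (Or.inr hk), Function.update_of_ne h0]
      · refine ⟨j.castPred hj, LinearMap.id, fun x => ?_⟩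
        funext k
        have h1 : Fin.last (n + 1) ≠ j := fun h => hj h.symm
        have h2 : (0 : Fin (n + 2)) ≠ j := fun h => hj0 h.symm
        have h3 : (0 : Fin (n + 1)) ≠ j.castPred hj := by
          intro h; apply h2; rw [← Fin.castSucc_castPred j hj, ← h]; rfl
        by_cases hk : k = 0
        · subst hk
          simp [face, h1, h2, h3]
        · have : (k.castSucc = j) ↔ k = j.castPred hj := by
            constructor
            · rintro rfl; simp
            · rintro rfl; simp
          simp [face, hk, Function.update_apply, this]
  · have hi' : (i : ℕ) < n + 1 := by
      have := i.2
      have h : (i : ℕ) ≠ n + 1 := fun h => hi (Fin.ext h)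
      omega
    rcases lt_trichotomy (j : ℕ) i with h | h | h
    · refine ⟨⟨j, by omega⟩, LinearMap.id, fun x => ?_⟩
      funext k
      simp only [face, hi, if_false, Fin.contractNth, Function.update_apply, Fin.ext_iff,
        Fin.val_castSucc, Fin.val_succ, LinearMap.id_apply]
      grind
    · refine ⟨⟨i, hi'⟩, LinearMap.mulRight ℂ (a ⟨i + 1, by omega⟩), fun x => ?_⟩
      funext k
      simp only [face, hi, if_false, Fin.contractNth, Function.update_apply, Fin.ext_iff,
        Fin.val_castSucc, Fin.val_succ, LinearMap.mulRight_apply]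
      have : (k : ℕ) = i → k.succ = ⟨i + 1, by omega⟩ := fun h => Fin.ext (by simp [h])
      grind
    · by_cases h' : (j : ℕ) = i + 1
      · refine ⟨⟨i, hi'⟩, LinearMap.mulLeft ℂ (a i), fun x => ?_⟩
        funext k
        simp only [face, hi, if_false, Fin.contractNth, Function.update_apply, Fin.ext_iff,
          Fin.val_castSucc, Fin.val_succ, LinearMap.mulLeft_apply]
        have : (k : ℕ) = i → k.castSucc = i := fun h => Fin.ext (by simp [h])
        grind
      · refine ⟨⟨j - 1, by omega⟩, LinearMap.id, fun x => ?_⟩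
        funext k
        simp only [face, hi, if_false, Fin.contractNth, Function.update_apply, Fin.ext_iff,
          Fin.val_castSucc, Fin.val_succ, LinearMap.id_apply]
        grind

/-- The `i`-th face as a multilinear map. -/
def faceMap (A : Type u) [Ring A] [Algebra ℂ A] (n : ℕ) (i : Fin (n + 2)) :
    MultilinearMap ℂ (fun _ : Fin (n + 2) => A) (Chain A n) :=
  MultilinearMap.mk' (fun a => PiTensorProduct.tprod ℂ (face i a))
    (fun a j x y => by
      obtain ⟨k, l, h⟩ := face_update i a j
      rw [h, h, h, map_add, MultilinearMap.map_update_add])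
    (fun a j c x => by
      obtain ⟨k, l, h⟩ := face_update i a j
      rw [h, h, map_smul, MultilinearMap.map_update_smul])

/-- The Hochschild boundary `b = ∑ᵢ (-1)ⁱ dᵢ` on unnormalized chains. -/
def bdry (A : Type u) [Ring A] [Algebra ℂ A] (n : ℕ) : Chain A (n + 1) →ₗ[ℂ] Chain A n :=
  PiTensorProduct.lift (∑ i : Fin (n + 2), (-1 : ℂ) ^ (i : ℕ) • faceMap A n i)

theorem bdry_tprod (n : ℕ) (a : Fin (n + 2) → A) :
    bdry A n (PiTensorProduct.tprod ℂ a) =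
      ∑ i : Fin (n + 2), (-1 : ℂ) ^ (i : ℕ) • PiTensorProduct.tprod ℂ (face i a) := by
  simp [bdry, faceMap]

/-- Degenerate chains: spanned by the `a₀ ⊗ a₁ ⊗ ⋯ ⊗ aₙ` with `aᵢ = 1` for some `i ≥ 1`. -/
def degenerate (A : Type u) [Ring A] [Algebra ℂ A] (n : ℕ) : Submodule ℂ (Chain A n) :=
  Submodule.span ℂ {t | ∃ a : Fin (n + 1) → A, (∃ i, i ≠ 0 ∧ a i = 1) ∧ PiTensorProduct.tprod ℂ a = t}

/-- Normalized chains: `A ⊗ (A / ℂ 1)^{⊗ n}`, as the quotient of `A ⊗ A^{⊗ n}` by the degenerate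
chains. -/
abbrev NChain (A : Type u) [Ring A] [Algebra ℂ A] (n : ℕ) : Type u := Chain A n ⧸ degenerate A n

theorem bdry_degenerate (n : ℕ) :
    degenerate A (n + 1) ≤ (degenerate A n).comap (bdry A n) := by
  rw [degenerate, Submodule.span_le]
  rintro _ ⟨a, ⟨j, hj0, hj⟩, rfl⟩
  simp only [Submodule.comap_coe, Set.mem_preimage, SetLike.mem_coe, bdry_tprod]
  have hjpos : 0 < (j : ℕ) := Nat.pos_of_ne_zero (fun h => hj0 (Fin.ext h))
  have hj2 := j.2
  -- the two faces that absorb the unit agree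
  set j' : Fin (n + 2) := ⟨j - 1, by omega⟩ with hj'
  have hne : j' ≠ j := by
    intro h
    have := congrArg Fin.val h
    simp only [hj'] at this
    omega
  have hj'last : j' ≠ Fin.last (n + 1) := by
    intro h
    have := congrArg Fin.val h
    simp only [hj', Fin.val_last] at this
    omega
  have hsame : face j' a = face j a := by
    funext k
    have hk2 := k.2
    rcases lt_trichotomy (k : ℕ) (j - 1) with h | h | h
    · rw [face_of_lt _ _ _ h (Or.inl hj'last)]
      by_cases hk0 : k = 0 ∧ j = Fin.last (n + 1)
      · obtain ⟨rfl, rfl⟩ := hk0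
        rw [face_zero_last, hj, one_mul, Fin.castSucc_zero]
      · rw [face_of_lt _ _ _ (by omega) (by tauto)]
    · have h3 : k.succ = j := Fin.ext (by rw [Fin.val_succ]; omega)
      rw [face_of_eq _ _ _ h, h3, hj, mul_one]
      by_cases hk0 : k = 0 ∧ j = Fin.last (n + 1)
      · obtain ⟨rfl, rfl⟩ := hk0
        rw [face_zero_last, hj, one_mul, Fin.castSucc_zero]
      · rw [face_of_lt _ _ _ (by omega) (by tauto)]
    · rw [face_of_gt _ _ _ h]
      by_cases h4 : (k : ℕ) = j
      · have h3 : k.castSucc = j := Fin.ext h4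
        rw [face_of_eq _ _ _ h4, h3, hj, one_mul]
      · rw [face_of_gt _ _ _ (by omega)]
  rw [← Finset.add_sum_erase _ _ (Finset.mem_univ j),
    ← Finset.add_sum_erase _ _ (Finset.mem_erase.2 ⟨hne, Finset.mem_univ j'⟩), ← add_assoc]
  refine Submodule.add_mem _ ?_ (Submodule.sum_mem _ fun i hi => ?_)
  · have hs : (-1 : ℂ) ^ (j : ℕ) = -(-1 : ℂ) ^ (j' : ℕ) := by
      have : (j : ℕ) = (j' : ℕ) + 1 := by simp only [hj']; omega
      rw [this, pow_succ]; ring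
    rw [hsame, hs, neg_smul, neg_add_cancel]
    exact Submodule.zero_mem _
  · -- every other face still contains the unit
    refine Submodule.smul_mem _ _ (Submodule.subset_span ⟨_, ?_, rfl⟩)
    simp only [Finset.mem_erase, Finset.mem_univ, and_true] at hi
    obtain ⟨hij', hij⟩ := hi
    have hv : (i : ℕ) ≠ j := fun h => hij (Fin.ext h)
    have hv' : (i : ℕ) ≠ j - 1 := fun h => hij' (Fin.ext h)
    by_cases hil : i = Fin.last (n + 1)
    · have hiv : (i : ℕ) = n + 1 := by rw [hil]; rfl
      refine ⟨⟨j, by omega⟩, fun h => ?_, ?_⟩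
      · have := congrArg Fin.val h
        simp only [Fin.val_zero] at this
        omega
      · have : (⟨(j : ℕ), by omega⟩ : Fin (n + 1)) ≠ 0 := fun h => by
          have := congrArg Fin.val h
          simp only [Fin.val_zero] at this
          omega
        simp only [face, hil, if_true, this, if_false]
        exact hj
    · rcases lt_or_gt_of_ne hv with h | h
      · refine ⟨⟨j - 1, by omega⟩, fun h0 => ?_, ?_⟩
        · have := congrArg Fin.val h0
          simp only [Fin.val_zero] at this
          omega
        · have h1 : ¬ ((j : ℕ) - 1 < i) := by omega
          have h2 : ¬ ((j : ℕ) - 1 = i) := by omega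
          simp only [face, hil, if_false, Fin.contractNth, h1, h2]
          rw [← hj]
          congr 1
          exact Fin.ext (by simp; omega)
      · have hin : (i : ℕ) ≠ n + 1 := fun h => hil (Fin.ext h)
        have hi2 := i.2
        refine ⟨⟨j, by omega⟩, fun h0 => ?_, ?_⟩
        · have := congrArg Fin.val h0
          simp only [Fin.val_zero] at this
          omega
        · simp only [face, hil, if_false, Fin.contractNth, h, if_true]
          exact hj

/-- The Hochschild boundary `b` on normalized chains. -/
def nbdry (A : Type u) [Ring A] [Algebra ℂ A] (n : ℕ) : NChain A (n + 1) →ₗ[ℂ] NChain A n :=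
  (degenerate A (n + 1)).mapQ (degenerate A n) (bdry A n) (bdry_degenerate n)

/-- Normalized Hochschild cycles: chains with `b c = 0` (no condition in degree `0`). -/
def IsCycle : {n : ℕ} → NChain A n → Prop
  | 0, _ => True
  | n + 1, c => nbdry A n c = 0

end Hochschild

section Chern

variable {A : Type u} [Ring A] [Algebra ℂ A] {ι : Type v} [Fintype ι]

/-- `⟨M₀ ⊗ M₁ ⊗ ⋯ ⊗ Mₙ⟩ = ∑ (M₀)_{i₀ i₁} ⊗ (M₁)_{i₁ i₂} ⊗ ⋯ ⊗ (Mₙ)_{iₙ i₀}` in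
`A ⊗ (A / ℂ 1)^{⊗ n}` (the index `k + 1` is cyclic). -/
def traceTensor {n : ℕ} (M : Fin (n + 1) → Matrix ι ι A) : Hochschild.NChain A n :=
  (Hochschild.degenerate A n).mkQ
    (∑ i : Fin (n + 1) → ι, PiTensorProduct.tprod ℂ fun k => M k (i k) (i (k + 1)))

/-- The component `ch_k(e) = ⟨(e - 1/2) ⊗ e^{⊗ 2k}⟩` of the Chern character. -/
def chEven [DecidableEq ι] (k : ℕ) (e : Matrix ι ι A) : Hochschild.NChain A (2 * k) :=
  traceTensor fun j => if j = 0 then e - (1 / 2 : ℂ) • (1 : Matrix ι ι A) else e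

/-- The component `ch_{k+1/2}(U) = ⟨U ⊗ U* ⊗ ⋯ ⊗ U ⊗ U* - U* ⊗ U ⊗ ⋯ ⊗ U* ⊗ U⟩`, with `2(k+1)`
factors in each term. -/
def chOdd [StarRing A] (k : ℕ) (U : Matrix ι ι A) : Hochschild.NChain A (2 * k + 1) :=
  traceTensor (fun j => if Even (j : ℕ) then U else U.conjTranspose) -
    traceTensor (fun j => if Even (j : ℕ) then U.conjTranspose else U)

/-- The spherical condition in even dimension `2m` for a projection `e`: `ch_k(e) = 0` for
`k < m`, and `ch_m(e)` is a nonzero Hochschild cycle (the volume form). -/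
structure IsEvenSpherical [DecidableEq ι] [StarRing A] (m : ℕ) (e : Matrix ι ι A) : Prop where
  idem : e * e = e
  selfAdj : e.conjTranspose = e
  vanish : ∀ k < m, chEven k e = 0
  cycle : Hochschild.IsCycle (chEven m e)
  ne_zero : chEven m e ≠ 0

/-- The spherical condition in odd dimension `2m + 1` for a unitary `U`: `ch_{k+1/2}(U) = 0` for
`k < m`, and `ch_{m+1/2}(U)` is a nonzero Hochschild cycle (the volume form). -/
structure IsOddSpherical [DecidableEq ι] [StarRing A] (m : ℕ) (U : Matrix ι ι A) : Prop where
  mul_star : U * U.conjTranspose = 1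
  star_mul : U.conjTranspose * U = 1
  vanish : ∀ k < m, chOdd k U = 0
  cycle : Hochschild.IsCycle (chOdd m U)
  ne_zero : chOdd m U ≠ 0

end Chern

/-! ### The deformed algebras -/

/-- A deformation tensor: `R l a b m` stands for `R^{l a}_{b m}`. -/
abbrev DefTensor : Type := Fin 4 → Fin 4 → Fin 4 → Fin 4 → ℂ

open FreeStarAlgebra in
/-- The defining relations: the components `x₁` commute, the components `x₂` commute,
`x₁^l x₂^a = R^{l a}_{b m} x₂^b x₁^m` and `x₂^a x₁^l = conj(R^{l a}_{b m}) x₁^m x₂^b`. -/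
inductive QuadRel (R : DefTensor) :
    FreeStarAlgebra (Fin 4 ⊕ Fin 4) → FreeStarAlgebra (Fin 4 ⊕ Fin 4) → Prop
  | one_one (l m : Fin 4) :
      QuadRel R (gen (Sum.inl l) * gen (Sum.inl m)) (gen (Sum.inl m) * gen (Sum.inl l))
  | two_two (a b : Fin 4) :
      QuadRel R (gen (Sum.inr a) * gen (Sum.inr b)) (gen (Sum.inr b) * gen (Sum.inr a))
  | one_two (l a : Fin 4) :
      QuadRel R (gen (Sum.inl l) * gen (Sum.inr a))
        (∑ b, ∑ m, R l a b m • (gen (Sum.inr b) * gen (Sum.inl m)))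
  | two_one (l a : Fin 4) :
      QuadRel R (gen (Sum.inr a) * gen (Sum.inl l))
        (∑ b, ∑ m, star (R l a b m) • (gen (Sum.inl m) * gen (Sum.inr b)))

theorem QuadRel.star_rel (R : DefTensor) (x y : FreeStarAlgebra (Fin 4 ⊕ Fin 4))
    (h : QuadRel R x y) : QuadRel R (star x) (star y) := by
  cases h with
  | one_one l m =>
    simp only [star_mul, FreeStarAlgebra.star_gen]
    exact .one_one m l
  | two_two a b =>
    simp only [star_mul, FreeStarAlgebra.star_gen]
    exact .two_two b a
  | one_two l a =>
    simp only [star_mul, star_sum, star_smul, FreeStarAlgebra.star_gen]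
    exact .two_one l a
  | two_one l a =>
    simp only [star_mul, star_sum, star_smul, star_star, FreeStarAlgebra.star_gen]
    exact .one_two l a

/-- The quadratic `*`-algebra `𝒜_R`. -/
def QuadAlg (R : DefTensor) : Type := RingQuot (QuadRel R)

namespace QuadAlg

variable (R : DefTensor)

instance : Ring (QuadAlg R) := inferInstanceAs (Ring (RingQuot (QuadRel R)))
instance : Algebra ℂ (QuadAlg R) := inferInstanceAs (Algebra ℂ (RingQuot (QuadRel R)))
instance : StarRing (QuadAlg R) := RingQuot.starRing (QuadRel R) (QuadRel.star_rel R)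
instance : StarModule ℂ (QuadAlg R) := starModule_ringQuot (QuadRel R) (QuadRel.star_rel R)

/-- The quotient map from the free `*`-algebra. -/
def mk : FreeStarAlgebra (Fin 4 ⊕ Fin 4) →ₐ[ℂ] QuadAlg R := RingQuot.mkAlgHom ℂ (QuadRel R)

/-- The hermitian generators `x₁^l`. -/
def x₁ (l : Fin 4) : QuadAlg R := mk R (FreeStarAlgebra.gen (Sum.inl l))

/-- The hermitian generators `x₂^a`. -/
def x₂ (a : Fin 4) : QuadAlg R := mk R (FreeStarAlgebra.gen (Sum.inr a))

theorem star_mk (x : FreeStarAlgebra (Fin 4 ⊕ Fin 4)) : star (mk R x) = mk R (star x) :=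
  star_mkAlgHom (QuadRel R) (QuadRel.star_rel R) x

theorem star_x₁ (l : Fin 4) : star (x₁ R l) = x₁ R l := by
  rw [x₁, star_mk, FreeStarAlgebra.star_gen]

theorem star_x₂ (a : Fin 4) : star (x₂ R a) = x₂ R a := by
  rw [x₂, star_mk, FreeStarAlgebra.star_gen]

end QuadAlg

/-- The matrix `𝓡` with `x^a x^b = 𝓡^{ab}_{cd} x^c x^d` for the eight generators together. -/
def bigR (R : DefTensor) :
    Matrix ((Fin 4 ⊕ Fin 4) × (Fin 4 ⊕ Fin 4)) ((Fin 4 ⊕ Fin 4) × (Fin 4 ⊕ Fin 4)) ℂ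
  | (Sum.inl l, Sum.inl m), (Sum.inl l', Sum.inl m') => if l' = m ∧ m' = l then 1 else 0
  | (Sum.inr a, Sum.inr b), (Sum.inr a', Sum.inr b') => if a' = b ∧ b' = a then 1 else 0
  | (Sum.inl l, Sum.inr a), (Sum.inr b, Sum.inl m) => R l a b m
  | (Sum.inr a, Sum.inl l), (Sum.inl m, Sum.inr b) => star (R l a b m)
  | _, _ => 0

section YangBaxter

variable {J : Type} [DecidableEq J]

/-- `S ⊗ I` on a threefold tensor product. -/
def leg₁₂ (S : Matrix (J × J) (J × J) ℂ) : Matrix (J × J × J) (J × J × J) ℂ :=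
  fun i j => S (i.1, i.2.1) (j.1, j.2.1) * if i.2.2 = j.2.2 then 1 else 0

/-- `I ⊗ S` on a threefold tensor product. -/
def leg₂₃ (S : Matrix (J × J) (J × J) ℂ) : Matrix (J × J × J) (J × J × J) ℂ :=
  fun i j => (if i.1 = j.1 then 1 else 0) * S (i.2.1, i.2.2) (j.2.1, j.2.2)

end YangBaxter

/-- The admissible deformation tensors: reality condition, Yang--Baxter equation, and centrality
of the two quadratic elements `(x₁)²` and `(x₂)²` in `𝒜_R`. -/
structure IsDeformation (R : DefTensor) : Prop where
  reality : ∀ l a c n : Fin 4,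
    ∑ b, ∑ m, star (R l a b m) * R m b c n = if l = n ∧ a = c then 1 else 0
  yangBaxter :
    leg₁₂ (bigR R) * leg₂₃ (bigR R) * leg₁₂ (bigR R) =
      leg₂₃ (bigR R) * leg₁₂ (bigR R) * leg₂₃ (bigR R)
  central₁ : (∑ l, QuadAlg.x₁ R l ^ 2) ∈ Subalgebra.center ℂ (QuadAlg R)
  central₂ : (∑ a, QuadAlg.x₂ R a ^ 2) ∈ Subalgebra.center ℂ (QuadAlg R)

/-- The sphere relation `(x₁)² + (x₂)² = 1`. -/
def SphereRel (R : DefTensor) (x y : QuadAlg R) : Prop :=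
  x = ∑ l, QuadAlg.x₁ R l ^ 2 + ∑ a, QuadAlg.x₂ R a ^ 2 ∧ y = 1

theorem SphereRel.star_rel (R : DefTensor) (x y : QuadAlg R) (h : SphereRel R x y) :
    SphereRel R (star x) (star y) := by
  obtain ⟨rfl, rfl⟩ := h
  simp [SphereRel, star_add, star_sum, star_pow, QuadAlg.star_x₁, QuadAlg.star_x₂]

/-- The coordinate algebra `𝒜(S⁷_R) = 𝒜_R / ((x₁)² + (x₂)² - 1)`. -/
def S7 (R : DefTensor) : Type := RingQuot (SphereRel R)

namespace S7

variable (R : DefTensor)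

instance : Ring (S7 R) := inferInstanceAs (Ring (RingQuot (SphereRel R)))
instance : Algebra ℂ (S7 R) := inferInstanceAs (Algebra ℂ (RingQuot (SphereRel R)))
instance : StarRing (S7 R) := RingQuot.starRing (SphereRel R) (SphereRel.star_rel R)
instance : StarModule ℂ (S7 R) := starModule_ringQuot (SphereRel R) (SphereRel.star_rel R)

/-- The quotient map from `𝒜_R`. -/
def mk : QuadAlg R →ₐ[ℂ] S7 R := RingQuot.mkAlgHom ℂ (SphereRel R)

/-- The coordinates `x₁^l` of the seven-sphere. -/
def x₁ (l : Fin 4) : S7 R := mk R (QuadAlg.x₁ R l)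

/-- The coordinates `x₂^a` of the seven-sphere. -/
def x₂ (a : Fin 4) : S7 R := mk R (QuadAlg.x₂ R a)

theorem star_mk (x : QuadAlg R) : star (mk R x) = mk R (star x) :=
  star_mkAlgHom (SphereRel R) (SphereRel.star_rel R) x

theorem star_x₁ (l : Fin 4) : star (x₁ R l) = x₁ R l := by
  rw [x₁, star_mk, QuadAlg.star_x₁]

theorem star_x₂ (a : Fin 4) : star (x₂ R a) = x₂ R a := by
  rw [x₂, star_mk, QuadAlg.star_x₂]

end S7

/-! ### Quaternions with entries in an algebra, as `2 × 2` matrices -/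

/-- The quaternion units `e₀ = 1` and `e_k = -i σ_k` in `M₂(ℂ)`. -/
def quatUnit : Fin 4 → Matrix (Fin 2) (Fin 2) ℂ :=
  ![1, !![0, -Complex.I; -Complex.I, 0], !![0, -1; 1, 0], !![-Complex.I, 0; 0, Complex.I]]

/-- The quaternion `x⁰ e₀ + x¹ e₁ + x² e₂ + x³ e₃` over an algebra `A`, in `M₂(A)`. -/
def quat {A : Type u} [Ring A] [Algebra ℂ A] (x : Fin 4 → A) : Matrix (Fin 2) (Fin 2) A :=
  ∑ m, (quatUnit m).map fun c => c • x m

/-- The component of `M ∈ M₂(A)` along `e_m`, that is `½ tr(e_m* M)`. -/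
def quatCoord {A : Type u} [Ring A] [Algebra ℂ A] (M : Matrix (Fin 2) (Fin 2) A) (m : Fin 4) : A :=
  (1 / 2 : ℂ) • ∑ i, ∑ j, star (quatUnit m i j) • M i j

/-- The column `|ψ⟩ = (x₂, x₁)ᵗ` of quaternions. -/
def ket (R : DefTensor) : Matrix (Fin 2 ⊕ Fin 2) (Fin 2) (S7 R) :=
  Matrix.fromRows (quat (S7.x₂ R)) (quat (S7.x₁ R))

/-- The action `|ψ⟩ ↦ |ψ⟩ w` of `SU(2)` on the generators is by `*`-automorphisms of `𝒜(S⁷_R)`. -/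
def SU2Acts (R : DefTensor) : Prop :=
  ∀ w ∈ Matrix.specialUnitaryGroup (Fin 2) ℂ, ∃ α : S7 R ≃⋆ₐ[ℂ] S7 R,
    (ket R).map α = ket R * w.map (algebraMap ℂ (S7 R))

/-! ### The four-sphere and the three-sphere -/

/-- The coordinates `Y⁰, …, Y³`, with `½ Y = x₂ x₁*`. -/
def Y7 (R : DefTensor) : Fin 4 → S7 R :=
  quatCoord ((2 : ℂ) • (quat (S7.x₂ R) * (quat (S7.x₁ R)).conjTranspose))

/-- The coordinate `Y⁴ = ‖x₂‖² - ‖x₁‖²`. -/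
def Y74 (R : DefTensor) : S7 R := ∑ a, S7.x₂ R a ^ 2 - ∑ l, S7.x₁ R l ^ 2

theorem star_Y74 (R : DefTensor) : star (Y74 R) = Y74 R := by
  simp [Y74, star_sub, star_sum, star_pow, S7.star_x₁, S7.star_x₂]

/-- The coordinate algebra `𝒜(S⁴_R)`: the `*`-subalgebra of `𝒜(S⁷_R)` generated by
`Y⁰, …, Y⁴`. -/
def S4 (R : DefTensor) : StarSubalgebra ℂ (S7 R) :=
  StarAlgebra.adjoin ℂ (insert (Y74 R) (Set.range (Y7 R)))

namespace S4

variable (R : DefTensor)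

/-- The coordinates `Y⁰, …, Y³` in `𝒜(S⁴_R)`. -/
def y (m : Fin 4) : S4 R :=
  ⟨Y7 R m, StarAlgebra.subset_adjoin ℂ _ (Set.mem_insert_of_mem _ (Set.mem_range_self m))⟩

/-- The coordinate `Y⁴` in `𝒜(S⁴_R)`. -/
def y4 : S4 R := ⟨Y74 R, StarAlgebra.subset_adjoin ℂ _ (Set.mem_insert _ _)⟩

/-- The quaternion `Y = Y⁰ e₀ + Y^k e_k`. -/
def Y : Matrix (Fin 2) (Fin 2) (S4 R) := quat (y R)

/-- The projection `p = ½ (1 + Y⁴, Y; Y*, 1 - Y⁴)`. -/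
def proj : Matrix (Fin 2 ⊕ Fin 2) (Fin 2 ⊕ Fin 2) (S4 R) :=
  (1 / 2 : ℂ) • Matrix.fromBlocks (Matrix.scalar (Fin 2) (1 + y4 R)) (Y R)
    (Y R).conjTranspose (Matrix.scalar (Fin 2) (1 - y4 R))

/-- The relation `Y⁴ = 0`. -/
def EquatorRel (x z : S4 R) : Prop := x = y4 R ∧ z = 0

theorem EquatorRel.star_rel (x z : S4 R) (h : EquatorRel R x z) :
    EquatorRel R (star x) (star z) := by
  obtain ⟨rfl, rfl⟩ := h
  exact ⟨Subtype.ext (star_Y74 R), star_zero _⟩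

end S4

/-- The coordinate algebra `𝒜(S³_R) = 𝒜(S⁴_R) / (Y⁴)`, of which `S⁴_R` is the suspension. -/
def S3 (R : DefTensor) : Type := RingQuot (S4.EquatorRel R)

namespace S3

variable (R : DefTensor)

instance : Ring (S3 R) := inferInstanceAs (Ring (RingQuot (S4.EquatorRel R)))
instance : Algebra ℂ (S3 R) := inferInstanceAs (Algebra ℂ (RingQuot (S4.EquatorRel R)))
instance : StarRing (S3 R) :=
  RingQuot.starRing (S4.EquatorRel R) (S4.EquatorRel.star_rel R)
instance : StarModule ℂ (S3 R) :=
  starModule_ringQuot (S4.EquatorRel R) (S4.EquatorRel.star_rel R)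

/-- The quotient map from `𝒜(S⁴_R)`. -/
def mk : S4 R →ₐ[ℂ] S3 R := RingQuot.mkAlgHom ℂ (S4.EquatorRel R)

/-- The unitary `Y` over `𝒜(S³_R)`. -/
def Y : Matrix (Fin 2) (Fin 2) (S3 R) := (S4.Y R).map (mk R)

end S3

end

end NCSpheres

/-! Isometry and unitarity. For hermitian commuting `x`, conjugate transposition of the quaternion
is the adjugate, so the sphere relation makes `ket R` an isometry. Hence `p` is a projection and `q
= 2p - 1 = (y4, Y; Y*, -y4)` satisfies `q * q = 1`; modulo `y4` its diagonal blocks say that `Y` is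
unitary.

Lower components and cycles. A unit in any slot but the zeroth kills a normalized chain, so
`ch_k(p)` is a multiple of `⟨q ⊗ ... ⊗ q⟩` (`chEven_eq`). For `k = 0` this is the trace of `q`,
which is zero. For `k = 1` the cubes of `y4` cancel between the blocks, and what remains is
`ch_{1/2}(Y)` with `y4` inserted in its three possible places. In `b ch_2(p)` the inner faces
contain `q * q = 1` and vanish, while the two outer faces are `1` inserted in front of `⟨q ⊗ q ⊗ q⟩
= 0`. The same computation with `Y` and `Y*` reduces `b ch_{3/2}(Y)` to `ch_{1/2}(Y)`.

Nonvanishing. Volume forms are tested on products of linear functionals. The Yang-Baxter equation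
and the reality condition let `𝒜_R` act on polynomials in `x₂`, by induction from a character of the
`x₁`. This yields normal ordering followed by evaluation at a point, which descends to the sphere
because the two squares are central (`exists_sphereEval`). Differences of such functionals prescribe
the entries of `Y` arbitrarily while killing `1` and the multiples of `Y⁴` (`exists_functional_Y7`).

Under `SU(2)`-symmetry the commutation matrices are combinations of the identity and the flip, and
the entries of `Y*` become a linear image `λ = starMap R` of those of `Y`. Vanishing of
`ch_{1/2}(Y)` gives `tr(a λb) = tr(λa b)`; vanishing of a volume form would give `tr(a λb c λd) =
tr(λa b λc d)`. Together they imply `λa b λd = λ(a λb d)`. But the matrices `starMatrix R k k'`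
commute, so they share a left eigenvector `c`; for the nonzero `d` with rows `c` and `0` this gives
`c λ(M d) = 0` for all `M`. Choosing `λa = 1` yields `c M λd = 0` for all `M`, so `λd = 0`, against
the bijectivity of `λ` (`trace_identities_contradiction`). -/

namespace NCSpheres

universe u v w

noncomputable section

open scoped TensorProduct

/-! ### Normalized chains: functoriality, insertion, evaluation, faces of matrix traces. -/

section

namespace Hochschild

variable {A : Type u} [Ring A] [Algebra ℂ A] {W : Type w} [AddCommGroup W] [Module ℂ W]

/-- The class of the elementary chain `a₀ ⊗ a₁ ⊗ ⋯ ⊗ aₙ`, as a multilinear map. -/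
def elem (A : Type u) [Ring A] [Algebra ℂ A] (n : ℕ) :
    MultilinearMap ℂ (fun _ : Fin (n + 1) => A) (NChain A n) :=
  (degenerate A n).mkQ.compMultilinearMap (PiTensorProduct.tprod ℂ)

theorem elem_eq_zero {n : ℕ} {a : Fin (n + 1) → A} {i : Fin (n + 1)} (hi : i ≠ 0)
    (ha : a i = 1) : elem A n a = 0 :=
  (Submodule.Quotient.mk_eq_zero _).2 (Submodule.subset_span ⟨a, ⟨i, hi, ha⟩, rfl⟩)

/-- A multilinear map vanishing on degenerate families descends to normalized chains. -/
def nlift {n : ℕ} (Φ : MultilinearMap ℂ (fun _ : Fin (n + 1) => A) W)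
    (h : ∀ (a : Fin (n + 1) → A) (i : Fin (n + 1)), i ≠ 0 → a i = 1 → Φ a = 0) :
    NChain A n →ₗ[ℂ] W :=
  (degenerate A n).liftQ (PiTensorProduct.lift Φ) (by
    rw [degenerate, Submodule.span_le]
    rintro _ ⟨a, ⟨i, hi, ha⟩, rfl⟩
    simpa using h a i hi ha)

theorem nlift_elem {n : ℕ} (Φ : MultilinearMap ℂ (fun _ : Fin (n + 1) => A) W)
    (h : ∀ (a : Fin (n + 1) → A) (i : Fin (n + 1)), i ≠ 0 → a i = 1 → Φ a = 0)
    (a : Fin (n + 1) → A) : nlift Φ h (elem A n a) = Φ a :=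
  PiTensorProduct.lift.tprod a

/-- Insertion of a fixed entry `c` at the position `p`. -/
def ins {n : ℕ} (p : Fin (n + 2)) (c : A) : NChain A n →ₗ[ℂ] NChain A (n + 1) :=
  nlift ((elem A (n + 1)).curryMid p c) fun a i hi ha => by
    rw [MultilinearMap.curryMid_apply_apply]
    refine elem_eq_zero (i := p.succAbove i) ?_ (by simpa using ha)
    intro h
    have h1 := congrArg Fin.val h
    have h2 : (i : ℕ) ≠ 0 := fun h => hi (Fin.ext h)
    simp only [Fin.succAbove] at h1
    split_ifs at h1
    · exact h2 h1
    · exact Nat.succ_ne_zero _ h1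

theorem ins_elem {n : ℕ} (p : Fin (n + 2)) (c : A) (a : Fin (n + 1) → A) :
    ins p c (elem A n a) = elem A (n + 1) (p.insertNth c a) := by
  rw [ins, nlift_elem, MultilinearMap.curryMid_apply_apply]

theorem nbdry_elem {n : ℕ} (a : Fin (n + 2) → A) :
    nbdry A n (elem A (n + 1) a) = ∑ j : Fin (n + 2), (-1 : ℂ) ^ (j : ℕ) • elem A n (face j a) := by
  have : nbdry A n (elem A (n + 1) a) =
      (degenerate A n).mkQ (bdry A n (PiTensorProduct.tprod ℂ a)) := rfl
  rw [this, bdry_tprod, map_sum]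
  simp only [map_smul]
  rfl

/-- The map on normalized chains induced by a homomorphism of algebras. -/
def nmap {B : Type v} [Ring B] [Algebra ℂ B] (f : A →ₐ[ℂ] B) (n : ℕ) :
    NChain A n →ₗ[ℂ] NChain B n :=
  nlift ((elem B n).compLinearMap fun _ => f.toLinearMap) fun a i hi ha => by
    rw [MultilinearMap.compLinearMap_apply]
    exact elem_eq_zero hi (by simp [ha])

theorem nmap_elem {B : Type v} [Ring B] [Algebra ℂ B] (f : A →ₐ[ℂ] B) {n : ℕ}
    (a : Fin (n + 1) → A) : nmap f n (elem A n a) = elem B n fun k => f (a k) := by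
  rw [nmap, nlift_elem]
  rfl

/-- The product of linear functionals, all but the first of which vanish at `1`. -/
def evalFun {n : ℕ} (f : Fin (n + 1) → A →ₗ[ℂ] ℂ) (hf : ∀ k, k ≠ 0 → f k 1 = 0) :
    NChain A n →ₗ[ℂ] ℂ :=
  nlift ((MultilinearMap.mkPiAlgebra ℂ (Fin (n + 1)) ℂ).compLinearMap f) fun a i hi ha => by
    rw [MultilinearMap.compLinearMap_apply, MultilinearMap.mkPiAlgebra_apply]
    exact Finset.prod_eq_zero (Finset.mem_univ i) (by rw [ha, hf i hi])

theorem evalFun_elem {n : ℕ} (f : Fin (n + 1) → A →ₗ[ℂ] ℂ) (hf : ∀ k, k ≠ 0 → f k 1 = 0)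
    (a : Fin (n + 1) → A) : evalFun f hf (elem A n a) = ∏ k, f k (a k) := by
  rw [evalFun, nlift_elem, MultilinearMap.compLinearMap_apply, MultilinearMap.mkPiAlgebra_apply]

end Hochschild

open Hochschild

variable {A : Type u} [Ring A] [Algebra ℂ A] {ι : Type v} [Fintype ι]

theorem traceTensor_eq_sum {n : ℕ} (M : Fin (n + 1) → Matrix ι ι A) :
    traceTensor M = ∑ i : Fin (n + 1) → ι, elem A n fun k => M k (i k) (i (k + 1)) := by
  rw [traceTensor, map_sum]
  rfl

/-- `traceTensor` as a multilinear map in the matrices. -/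
def traceMulti (A : Type u) [Ring A] [Algebra ℂ A] (ι : Type v) [Fintype ι] (n : ℕ) :
    MultilinearMap ℂ (fun _ : Fin (n + 1) => Matrix ι ι A) (NChain A n) :=
  ∑ i : Fin (n + 1) → ι, (elem A n).compLinearMap fun k => Matrix.entryLinearMap ℂ A (i k) (i (k + 1))

theorem traceMulti_apply {n : ℕ} (M : Fin (n + 1) → Matrix ι ι A) :
    traceMulti A ι n M = traceTensor M := by
  rw [traceTensor_eq_sum, traceMulti, sum_apply]
  rfl

/-- Each summand is either degenerate (diagonal entry `1` in the slot `k`) or has an entry `0`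
there. -/
theorem traceTensor_eq_zero [DecidableEq ι] {n : ℕ} {M : Fin (n + 1) → Matrix ι ι A}
    {k : Fin (n + 1)} (hk : k ≠ 0) (hM : M k = 1) : traceTensor M = 0 := by
  rw [traceTensor_eq_sum]
  refine Finset.sum_eq_zero fun i _ => ?_
  by_cases h : i k = i (k + 1)
  · exact elem_eq_zero hk (by rw [hM, h, Matrix.one_apply_eq])
  · exact MultilinearMap.map_coord_zero _ k (by rw [hM, Matrix.one_apply_ne h])

theorem traceTensor_update_sub_one [DecidableEq ι] {n : ℕ} (M : Fin (n + 1) → Matrix ι ι A)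
    {k : Fin (n + 1)} (hk : k ≠ 0) (c : ℂ) :
    traceTensor (Function.update M k (M k - c • 1)) = traceTensor M := by
  have h : traceTensor (Function.update M k (1 : Matrix ι ι A)) = 0 :=
    traceTensor_eq_zero hk (Function.update_self ..)
  rw [← traceMulti_apply] at h ⊢
  rw [MultilinearMap.map_update_sub, MultilinearMap.map_update_smul, h, smul_zero, sub_zero,
    Function.update_eq_self, traceMulti_apply]

/-- Scalar matrices may be subtracted in all places but the first. -/
theorem traceTensor_sub_one [DecidableEq ι] {n : ℕ} (M : Fin (n + 1) → Matrix ι ι A) (c : ℂ)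
    (s : Finset (Fin (n + 1))) (hs : 0 ∉ s) :
    traceTensor (fun k => if k ∈ s then M k - c • 1 else M k) = traceTensor M := by
  induction s using Finset.induction_on with
  | empty => simp
  | insert k s hk ih =>
    rw [← ih (fun h => hs (Finset.mem_insert_of_mem h)),
      ← traceTensor_update_sub_one (fun k => if k ∈ s then M k - c • 1 else M k)
        (k := k) (fun h => hs (h ▸ Finset.mem_insert_self k s)) c]
    congr 1
    funext j
    by_cases hj : j = k
    · subst hj
      simp [hk]
    · simp [hj]

/-- The zeroth slot is already centred at `1/2`, and centring the others costs nothing in normalized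
chains; each of the `2k + 1` slots then contributes a factor `1/2`. For an idempotent this replaces
`e` by an involution. -/
theorem chEven_eq [DecidableEq ι] (k : ℕ) (e : Matrix ι ι A) :
    chEven k e = (1 / 2 : ℂ) ^ (2 * k + 1) • traceTensor fun _ => (2 : ℂ) • e - 1 := by
  have h := traceTensor_sub_one (n := 2 * k)
    (fun j => if j = 0 then e - (1 / 2 : ℂ) • (1 : Matrix ι ι A) else e) (1 / 2)
    (Finset.univ.erase 0) (by simp)
  rw [chEven, ← h]
  have h2 : e - (1 / 2 : ℂ) • (1 : Matrix ι ι A) = (1 / 2 : ℂ) • ((2 : ℂ) • e - 1) := by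
    rw [smul_sub, smul_smul]
    norm_num
  have h3 := (traceMulti A ι (2 * k)).map_smul_univ (fun _ => (1 / 2 : ℂ))
    (fun _ => (2 : ℂ) • e - 1)
  simp only [Finset.prod_const, Finset.card_univ, Fintype.card_fin, traceMulti_apply] at h3
  rw [← h3]
  congr 1
  funext j
  rw [← h2]
  by_cases hj : j = 0
  · simp [hj]
  · simp [hj]

theorem evalFun_traceTensor [DecidableEq ι] {n : ℕ} (f : Fin (n + 1) → A →ₗ[ℂ] ℂ)
    (hf : ∀ k, k ≠ 0 → f k 1 = 0) (M : Fin (n + 1) → Matrix ι ι A) :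
    evalFun f hf (traceTensor M) =
      ∑ i : Fin (n + 1) → ι, ∏ k, (M k).map (f k) (i k) (i (k + 1)) := by
  rw [traceTensor_eq_sum, map_sum]
  simp only [evalFun_elem, Matrix.map_apply]

theorem nmap_traceTensor {B : Type w} [Ring B] [Algebra ℂ B] (f : A →ₐ[ℂ] B) {n : ℕ}
    (M : Fin (n + 1) → Matrix ι ι A) :
    nmap f n (traceTensor M) = traceTensor fun k => (M k).map f := by
  rw [traceTensor_eq_sum, traceTensor_eq_sum, map_sum]
  simp only [nmap_elem, Matrix.map_apply]

/-- A unit in the zeroth slot is not degenerate; it merely identifies the first two indices. The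
outer faces of the boundary have this form. -/
theorem traceTensor_cons_one [DecidableEq ι] {n : ℕ} (M : Fin (n + 1) → Matrix ι ι A) :
    traceTensor (Fin.cons (1 : Matrix ι ι A) M : Fin (n + 2) → Matrix ι ι A) =
      ins (0 : Fin (n + 2)) (1 : A) (traceTensor M) := by
  rw [traceTensor_eq_sum, traceTensor_eq_sum, map_sum,
    ← (Fin.consEquiv fun _ : Fin (n + 2) => ι).sum_comp, Fintype.sum_prod_type, Finset.sum_comm]
  refine Finset.sum_congr rfl fun i _ => ?_
  rw [Finset.sum_eq_single (i 0)]
  · rw [ins_elem]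
    congr 1
    funext k
    refine Fin.cases ?_ (fun k => ?_) k
    · have : (0 : Fin (n + 2)) + 1 = (0 : Fin (n + 1)).succ := by simp
      rw [this]
      simp [Fin.consEquiv]
    · refine Fin.lastCases ?_ (fun k => ?_) k
      · rw [Fin.succ_last, Fin.last_add_one, ← Fin.succ_last]
        simp [Fin.consEquiv]
      · have h1 : k.castSucc.succ + 1 = k.succ.succ := by
          rw [← Fin.castSucc_succ, Fin.coeSucc_eq_succ]
        have h2 : k.castSucc + 1 = k.succ := Fin.coeSucc_eq_succ
        rw [h1]
        simp [Fin.consEquiv, h2]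
  · intro x _ hx
    refine MultilinearMap.map_coord_zero _ 0 ?_
    have : (0 : Fin (n + 2)) + 1 = (0 : Fin (n + 1)).succ := by simp
    rw [this]
    simp [Fin.consEquiv, hx]
  · intro h
    exact absurd (Finset.mem_univ _) h

/-- Linearity in the slot `k`; it carries out the summation over the index contracted by a matrix
product. -/
theorem elem_sum_coord {κ : Type*} [Fintype κ] {n : ℕ} (k : Fin (n + 1)) (a : κ → Fin (n + 1) → A)
    (b : Fin (n + 1) → A) (hk : ∑ x, a x k = b k) (h : ∀ x, ∀ j, j ≠ k → a x j = b j) :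
    ∑ x, elem A n (a x) = elem A n b := by
  have h1 : ∀ x, a x = Function.update b k (a x k) := fun x => by
    funext j
    by_cases hj : j = k
    · subst hj; simp
    · rw [Function.update_of_ne hj, h x j hj]
  have h2 : elem A n b = elem A n (Function.update b k (∑ x, a x k)) := by
    rw [hk, Function.update_eq_self]
  rw [h2, MultilinearMap.map_update_sum]
  exact Finset.sum_congr rfl fun x _ => by rw [← h1]

/-- The faces of the trace of a tensor product of matrices. -/
theorem sum_face [DecidableEq ι] {n : ℕ} (M : Fin (n + 2) → Matrix ι ι A) (j : Fin (n + 2)) :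
    ∑ i : Fin (n + 2) → ι, elem A n (face j fun k => M k (i k) (i (k + 1))) =
      traceTensor (face j M) := by
  rw [traceTensor_eq_sum]
  have hcs : ∀ k : Fin (n + 1), k.castSucc + 1 = k.succ := fun k => Fin.coeSucc_eq_succ
  refine Fin.lastCases ?_ (fun j => ?_) j
  -- The last face forms `M (n + 1) * M 0`, which contracts the index `0`. The remaining indices
  -- must be shifted cyclically, since this product runs from the old last index to the old index
  -- `1`.
  · rw [← (Fin.consEquiv fun _ : Fin (n + 2) => ι).sum_comp, Fintype.sum_prod_type,
      Finset.sum_comm,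
      ← (Equiv.arrowCongr (Equiv.addRight (1 : Fin (n + 1))).symm (Equiv.refl ι)).sum_comp]
    refine Finset.sum_congr rfl fun i _ => ?_
    have hi : ∀ k : Fin (n + 1), k ≠ 0 → ∀ x : ι,
        (Fin.cons x (fun k => i (k + 1)) : Fin (n + 2) → ι) k.castSucc = i k := by
      intro k hk x
      obtain ⟨k, rfl⟩ := Fin.exists_succ_eq.2 hk
      rw [Fin.castSucc_succ, Fin.cons_succ, Fin.coeSucc_eq_succ]
    have hs : ∀ (k : Fin (n + 1)) (x : ι),
        (Fin.cons x (fun k => i (k + 1)) : Fin (n + 2) → ι) k.succ = i (k + 1) :=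
      fun k x => Fin.cons_succ ..
    refine elem_sum_coord 0 _ _ ?_ fun x k hk => ?_
    · simp only [face_zero_last, Matrix.mul_apply]
      refine Finset.sum_congr rfl fun x _ => ?_
      change M (Fin.last (n + 1))
        ((Fin.cons x (fun k => i (k + 1)) : Fin (n + 2) → ι) (Fin.last (n + 1)))
        ((Fin.cons x (fun k => i (k + 1)) : Fin (n + 2) → ι) (Fin.last (n + 1) + 1)) *
        M 0 x ((Fin.cons x (fun k => i (k + 1)) : Fin (n + 2) → ι) (0 + 1)) = _
      have h0 : (0 : Fin (n + 2)) + 1 = (0 : Fin (n + 1)).succ := hcs 0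
      rw [Fin.last_add_one, ← Fin.succ_last, hs, Fin.last_add_one, h0, hs]
      rfl
    · rw [face_of_lt _ _ _ k.2 (Or.inr hk), face_of_lt _ _ _ k.2 (Or.inr hk)]
      change M k.castSucc
        ((Fin.cons x (fun k => i (k + 1)) : Fin (n + 2) → ι) k.castSucc)
        ((Fin.cons x (fun k => i (k + 1)) : Fin (n + 2) → ι) (k.castSucc + 1)) = _
      rw [hi k hk, hcs, hs]
  -- The face `j` forms `M j * M (j + 1)`, so the contracted index is the one at `j + 1`.
  · rw [← (Fin.insertNthEquiv (fun _ : Fin (n + 2) => ι) j.succ).sum_comp, Fintype.sum_prod_type,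
      Finset.sum_comm]
    refine Finset.sum_congr rfl fun i _ => ?_
    have hj : j.castSucc ≠ Fin.last (n + 1) := Fin.castSucc_ne_last j
    have hlt : ∀ k : Fin (n + 1), k ≤ j → ∀ x : ι,
        (j.succ.insertNth x i : Fin (n + 2) → ι) k.castSucc = i k := by
      intro k hk x
      rw [← Fin.succAbove_of_castSucc_lt j.succ k (Fin.castSucc_lt_succ_iff.2 hk),
        Fin.insertNth_apply_succAbove]
    have hgt : ∀ k : Fin (n + 1), j < k → ∀ x : ι,
        (j.succ.insertNth x i : Fin (n + 2) → ι) k.succ = i k := by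
      intro k hk x
      rw [← Fin.succAbove_of_lt_succ j.succ k (Fin.succ_lt_succ_iff.2 hk),
        Fin.insertNth_apply_succAbove]
    have hnext : ∀ k : Fin (n + 1), j ≤ k → ∀ x : ι,
        (j.succ.insertNth x i : Fin (n + 2) → ι) (k.succ + 1) = i (k + 1) := by
      intro k hk x
      refine Fin.lastCases (fun hk => ?_) (fun k hk => ?_) k hk
      · rw [Fin.succ_last, Fin.last_add_one, Fin.last_add_one, ← Fin.castSucc_zero,
          hlt 0 (Fin.zero_le _)]
      · rw [← Fin.castSucc_succ, hcs, Fin.coeSucc_eq_succ, hgt]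
        exact lt_of_le_of_lt hk Fin.castSucc_lt_succ
    refine elem_sum_coord j _ _ ?_ fun x k hk => ?_
    · simp only [face_of_eq (j.castSucc) _ j (by simp), Matrix.mul_apply]
      refine Finset.sum_congr rfl fun x _ => ?_
      change M j.castSucc ((j.succ.insertNth x i : Fin (n + 2) → ι) j.castSucc)
        ((j.succ.insertNth x i : Fin (n + 2) → ι) (j.castSucc + 1)) *
        M j.succ ((j.succ.insertNth x i : Fin (n + 2) → ι) j.succ)
        ((j.succ.insertNth x i : Fin (n + 2) → ι) (j.succ + 1)) = _
      rw [hlt j le_rfl, hcs, hnext j le_rfl, Fin.insertNth_apply_same]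
    · rcases lt_or_gt_of_ne hk with h | h
      · rw [face_of_lt _ _ _ h (Or.inl hj),
          face_of_lt _ _ _ h (Or.inl hj)]
        change M k.castSucc ((j.succ.insertNth x i : Fin (n + 2) → ι) k.castSucc)
          ((j.succ.insertNth x i : Fin (n + 2) → ι) (k.castSucc + 1)) = _
        have hk1 : (j.succ.insertNth x i : Fin (n + 2) → ι) k.succ = i (k + 1) := by
          refine Fin.lastCases (fun h => ?_) (fun k h => ?_) k h
          · exact absurd h (Fin.le_last j).not_gt
          · rw [← Fin.castSucc_succ, Fin.coeSucc_eq_succ, hlt]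
            exact Fin.castSucc_lt_iff_succ_le.1 h
        rw [hlt k h.le, hcs, hk1]
      · rw [face_of_gt _ _ _ h, face_of_gt _ _ _ h]
        change M k.succ ((j.succ.insertNth x i : Fin (n + 2) → ι) k.succ)
          ((j.succ.insertNth x i : Fin (n + 2) → ι) (k.succ + 1)) = _
        rw [hgt k h, hnext k h.le]

theorem nbdry_traceTensor [DecidableEq ι] {n : ℕ} (M : Fin (n + 2) → Matrix ι ι A) :
    nbdry A n (traceTensor M) =
      ∑ j : Fin (n + 2), (-1 : ℂ) ^ (j : ℕ) • traceTensor (face j M) := by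
  rw [traceTensor_eq_sum, map_sum]
  simp only [nbdry_elem]
  rw [Finset.sum_comm]
  simp only [← Finset.smul_sum, sum_face]

end

/-! ### Low-degree traces, the block reflection, and the cycle conditions. -/

section

open Hochschild

theorem sum_fin_succ_arrow {ι : Type v} [Fintype ι] {W : Type w} [AddCommMonoid W] {n : ℕ}
    (f : (Fin (n + 1) → ι) → W) :
    ∑ i, f i = ∑ x, ∑ i : Fin n → ι, f (Matrix.vecCons x i) := by
  rw [← (Fin.consEquiv fun _ : Fin (n + 1) => ι).sum_comp, Fintype.sum_prod_type]
  rfl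

theorem sum_fin_zero_arrow {ι : Type v} [Fintype ι] {W : Type w} [AddCommMonoid W]
    (f : (Fin 0 → ι) → W) : ∑ i, f i = f ![] := by
  rw [Fintype.sum_unique]
  congr 1

section Blocks

variable {A : Type u} [Ring A] [Algebra ℂ A] {ι : Type v} [Fintype ι]

theorem vec_two_eq {α : Type w} (f : Fin 2 → α) : f = ![f 0, f 1] := by
  funext k; fin_cases k <;> rfl

theorem vec_three_eq {α : Type w} (f : Fin 3 → α) : f = ![f 0, f 1, f 2] := by
  funext k; fin_cases k <;> rfl

theorem traceTensor_one (M : Fin 2 → Matrix ι ι A) :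
    traceTensor M = ∑ i, ∑ j, elem A 1 ![M 0 i j, M 1 j i] := by
  rw [traceTensor_eq_sum]
  simp only [sum_fin_succ_arrow, sum_fin_zero_arrow]
  refine Finset.sum_congr rfl fun i _ => Finset.sum_congr rfl fun j _ => ?_
  congr 1
  exact vec_two_eq _

theorem traceTensor_two (M : Fin 3 → Matrix ι ι A) :
    traceTensor M = ∑ i, ∑ j, ∑ k, elem A 2 ![M 0 i j, M 1 j k, M 2 k i] := by
  rw [traceTensor_eq_sum]
  simp only [sum_fin_succ_arrow, sum_fin_zero_arrow]
  refine Finset.sum_congr rfl fun i _ => Finset.sum_congr rfl fun j _ =>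
    Finset.sum_congr rfl fun k _ => ?_
  congr 1
  exact vec_three_eq _

/-- The matrix `(y, Y; Y', -y)`. -/
def reflMatrix (y : A) (Y Y' : Matrix (Fin 2) (Fin 2) A) :
    Matrix (Fin 2 ⊕ Fin 2) (Fin 2 ⊕ Fin 2) A :=
  Matrix.fromBlocks (Matrix.scalar (Fin 2) y) Y Y' (Matrix.scalar (Fin 2) (-y))

theorem elem_two_zero_left (a b : A) : elem A 2 ![0, a, b] = 0 :=
  MultilinearMap.map_coord_zero _ 0 rfl

theorem elem_two_zero_mid (a b : A) : elem A 2 ![a, 0, b] = 0 :=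
  MultilinearMap.map_coord_zero _ 1 rfl

theorem elem_two_zero_right (a b : A) : elem A 2 ![a, b, 0] = 0 :=
  MultilinearMap.map_coord_zero _ 2 rfl

theorem elem_two_neg_left (a b c : A) : elem A 2 ![-a, b, c] = -elem A 2 ![a, b, c] := by
  have h := (elem A 2).map_update_smul ![a, b, c] 0 (-1) a
  rw [neg_one_smul, neg_one_smul] at h
  convert h using 2
  · funext k; fin_cases k <;> rfl
  · rw [vec_three_eq (Function.update _ _ _)]; rfl

theorem elem_two_neg_mid (a b c : A) : elem A 2 ![a, -b, c] = -elem A 2 ![a, b, c] := by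
  have h := (elem A 2).map_update_smul ![a, b, c] 1 (-1) b
  rw [neg_one_smul, neg_one_smul] at h
  convert h using 2
  · funext k; fin_cases k <;> rfl
  · rw [vec_three_eq (Function.update _ _ _)]; rfl

theorem elem_two_neg_right (a b c : A) : elem A 2 ![a, b, -c] = -elem A 2 ![a, b, c] := by
  have h := (elem A 2).map_update_smul ![a, b, c] 2 (-1) c
  rw [neg_one_smul, neg_one_smul] at h
  convert h using 2
  · funext k; fin_cases k <;> rfl
  · rw [vec_three_eq (Function.update _ _ _)]; rfl

/-- A closed path of length three between the two blocks uses `y` once or three times. The cubes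
cancel; the rest is `⟨Y ⊗ Y'⟩ - ⟨Y' ⊗ Y⟩` with `y` inserted at the positions `0`, `1`, `2` with
signs `+`, `-`, `+`. -/
theorem traceTensor_reflMatrix_eq_zero (y : A) (Y Y' : Matrix (Fin 2) (Fin 2) A)
    (h : traceTensor (![Y, Y'] : Fin 2 → Matrix (Fin 2) (Fin 2) A) = traceTensor ![Y', Y]) :
    traceTensor (fun _ : Fin 3 => reflMatrix y Y Y') = 0 := by
  have key : ∀ p : Fin 3, _ := fun p => congrArg (ins p y) h
  have h0 := key 0
  have h1 := key 1
  have h2 := key 2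
  have e0 : ∀ a b : A, ins (0 : Fin 3) y (elem A 1 ![a, b]) = elem A 2 ![y, a, b] := by
    intro a b
    rw [ins_elem, vec_three_eq (Fin.insertNth _ _ _)]
    rfl
  have e1 : ∀ a b : A, ins (1 : Fin 3) y (elem A 1 ![a, b]) = elem A 2 ![a, y, b] := by
    intro a b
    rw [ins_elem, vec_three_eq (Fin.insertNth _ _ _)]
    rfl
  have e2 : ∀ a b : A, ins (2 : Fin 3) y (elem A 1 ![a, b]) = elem A 2 ![a, b, y] := by
    intro a b
    rw [ins_elem, vec_three_eq (Fin.insertNth _ _ _)]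
    rfl
  simp only [traceTensor_one, map_add, e0, e1, e2, Fin.sum_univ_two, Matrix.cons_val_zero,
    Matrix.cons_val_one] at h0 h1 h2
  simp only [traceTensor_two, Fintype.sum_sum_type, Fin.sum_univ_two, reflMatrix,
    Matrix.fromBlocks_apply₁₁, Matrix.fromBlocks_apply₁₂, Matrix.fromBlocks_apply₂₁,
    Matrix.fromBlocks_apply₂₂, Matrix.scalar_apply, Matrix.diagonal_apply_eq,
    Matrix.diagonal_apply_ne _ (zero_ne_one : (0 : Fin 2) ≠ 1),
    Matrix.diagonal_apply_ne _ (one_ne_zero : (1 : Fin 2) ≠ 0),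
    elem_two_zero_left, elem_two_zero_mid, elem_two_zero_right,
    elem_two_neg_left, elem_two_neg_mid, elem_two_neg_right, neg_neg]
  linear_combination (norm := module) h0 - h1 + h2

theorem chOdd_zero_eq [StarRing A] (U : Matrix ι ι A) :
    chOdd 0 U = traceTensor (![U, U.conjTranspose] : Fin 2 → Matrix ι ι A) -
      traceTensor ![U.conjTranspose, U] := by
  rw [chOdd]
  congr 2 <;> (funext k; fin_cases k <;> simp)

theorem chOdd_one_eq [StarRing A] (U : Matrix ι ι A) :
    chOdd 1 U = traceTensor (![U, U.conjTranspose, U, U.conjTranspose] : Fin 4 → Matrix ι ι A) -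
      traceTensor ![U.conjTranspose, U, U.conjTranspose, U] := by
  rw [chOdd]
  have h3 : ¬ Even 3 := by decide
  congr 2 <;> (funext k; fin_cases k <;> simp [h3])

variable [DecidableEq ι]

/-- The faces `0` and `4` have the same sign and do not cancel, which is why the vanishing in degree
two is required. -/
theorem nbdry_traceTensor_const {q : Matrix ι ι A} (hq : q * q = 1)
    (h : traceTensor (fun _ : Fin 3 => q) = 0) :
    nbdry A 3 (traceTensor fun _ : Fin 5 => q) = 0 := by
  have h1 : traceTensor (Fin.cons (1 : Matrix ι ι A) (fun _ => q) : Fin 4 → Matrix ι ι A) = 0 := by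
    rw [traceTensor_cons_one, h, map_zero]
  have hf0 : face (0 : Fin 5) (fun _ => q) = (Fin.cons 1 (fun _ => q) : Fin 4 → Matrix ι ι A) := by
    rw [← hq]; funext k; fin_cases k <;> rfl
  have hf4 : face (4 : Fin 5) (fun _ => q) = (Fin.cons 1 (fun _ => q) : Fin 4 → Matrix ι ι A) := by
    rw [← hq]; funext k; fin_cases k <;> rfl
  have hf1 : traceTensor (face (1 : Fin 5) (fun _ => q)) = 0 :=
    traceTensor_eq_zero (k := 1) (by decide) hq
  have hf2 : traceTensor (face (2 : Fin 5) (fun _ => q)) = 0 :=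
    traceTensor_eq_zero (k := 2) (by decide) hq
  have hf3 : traceTensor (face (3 : Fin 5) (fun _ => q)) = 0 :=
    traceTensor_eq_zero (k := 3) (by decide) hq
  rw [nbdry_traceTensor, Fin.sum_univ_five, hf0, hf4, hf1, hf2, hf3, h1]
  simp

/-- The inner faces are degenerate, and the outer ones leave `1` inserted in front of `⟨U ⊗ V⟩ - ⟨V
⊗ U⟩`. -/
theorem nbdry_traceTensor_alternating {U V : Matrix ι ι A} (hUV : U * V = 1) (hVU : V * U = 1)
    (h : traceTensor (![U, V] : Fin 2 → Matrix ι ι A) = traceTensor ![V, U]) :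
    nbdry A 2 (traceTensor (![U, V, U, V] : Fin 4 → Matrix ι ι A) -
      traceTensor ![V, U, V, U]) = 0 := by
  have h1 : ∀ X Z : Matrix ι ι A, traceTensor (![1, X, Z] : Fin 3 → Matrix ι ι A) =
      ins (0 : Fin 3) (1 : A) (traceTensor ![X, Z]) := fun X Z =>
    traceTensor_cons_one (n := 1) ![X, Z]
  have key : ∀ X Z : Matrix ι ι A, X * Z = 1 → Z * X = 1 →
      nbdry A 2 (traceTensor (![X, Z, X, Z] : Fin 4 → Matrix ι ι A)) =
      traceTensor ![1, X, Z] - traceTensor ![1, Z, X] := by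
    intro X Z hXZ hZX
    have f0 : face (0 : Fin 4) ![X, Z, X, Z] = ![1, X, Z] := by
      rw [← hXZ]; funext k; fin_cases k <;> rfl
    have f3 : face (3 : Fin 4) ![X, Z, X, Z] = ![1, Z, X] := by
      rw [← hZX]; funext k; fin_cases k <;> rfl
    have f1 : traceTensor (face (1 : Fin 4) ![X, Z, X, Z]) = 0 :=
      traceTensor_eq_zero (k := 1) (by decide) hZX
    have f2 : traceTensor (face (2 : Fin 4) ![X, Z, X, Z]) = 0 :=
      traceTensor_eq_zero (k := 2) (by decide) hXZ
    rw [nbdry_traceTensor, Fin.sum_univ_four, f0, f1, f2, f3]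
    simp only [Fin.val_zero, pow_zero, one_smul, smul_zero, add_zero]
    have : (-1 : ℂ) ^ ((3 : Fin 4) : ℕ) = -1 := by norm_num
    rw [this, neg_one_smul, sub_eq_add_neg]
  rw [map_sub, key U V hUV hVU, key V U hVU hUV, h1, h1, h]
  abel

/-! ### Evaluation on functionals -/

theorem evalFun_traceTensor_one (f : Fin 2 → A →ₗ[ℂ] ℂ) (hf : ∀ k, k ≠ 0 → f k 1 = 0)
    (M : Fin 2 → Matrix ι ι A) :
    evalFun f hf (traceTensor M) = ((M 0).map (f 0) * (M 1).map (f 1)).trace := by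
  rw [evalFun_traceTensor]
  simp only [sum_fin_succ_arrow, sum_fin_zero_arrow, Matrix.trace, Matrix.diag, Matrix.mul_apply]
  refine Finset.sum_congr rfl fun i _ => Finset.sum_congr rfl fun j _ => ?_
  rw [Fin.prod_univ_two]
  rfl

theorem evalFun_traceTensor_three (f : Fin 4 → A →ₗ[ℂ] ℂ) (hf : ∀ k, k ≠ 0 → f k 1 = 0)
    (M : Fin 4 → Matrix ι ι A) :
    evalFun f hf (traceTensor M) =
      ((M 0).map (f 0) * ((M 1).map (f 1) * ((M 2).map (f 2) * (M 3).map (f 3)))).trace := by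
  rw [evalFun_traceTensor]
  simp only [sum_fin_succ_arrow, sum_fin_zero_arrow, Matrix.trace, Matrix.diag, Matrix.mul_apply,
    Finset.mul_sum]
  refine Finset.sum_congr rfl fun i _ => Finset.sum_congr rfl fun j _ =>
    Finset.sum_congr rfl fun k _ => Finset.sum_congr rfl fun l _ => ?_
  rw [Fin.prod_univ_four, mul_assoc, mul_assoc]
  rfl

theorem evalFun_traceTensor_four (f : Fin 5 → A →ₗ[ℂ] ℂ) (hf : ∀ k, k ≠ 0 → f k 1 = 0)
    (M : Fin 5 → Matrix ι ι A) :
    evalFun f hf (traceTensor M) =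
      ((M 0).map (f 0) * ((M 1).map (f 1) * ((M 2).map (f 2) *
        ((M 3).map (f 3) * (M 4).map (f 4))))).trace := by
  rw [evalFun_traceTensor]
  simp only [sum_fin_succ_arrow, sum_fin_zero_arrow, Matrix.trace, Matrix.diag, Matrix.mul_apply,
    Finset.mul_sum]
  refine Finset.sum_congr rfl fun i _ => Finset.sum_congr rfl fun j _ =>
    Finset.sum_congr rfl fun k _ => Finset.sum_congr rfl fun l _ =>
    Finset.sum_congr rfl fun m _ => ?_
  rw [Fin.prod_univ_five, mul_assoc, mul_assoc, mul_assoc]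
  rfl

end Blocks

end

/-! ### Quaternions over an algebra; the projection `p` and the unitary `Y`. -/

section

open Hochschild

section Quat

variable {A : Type u} [Ring A] [Algebra ℂ A]

theorem quat_apply (x : Fin 4 → A) (i j : Fin 2) :
    quat x i j = ∑ m, quatUnit m i j • x m := by
  simp [quat, Matrix.sum_apply]

theorem I_smul_I_smul (a : A) : Complex.I • Complex.I • a = -a := by
  rw [smul_smul, Complex.I_mul_I, neg_one_smul]

theorem quat_zero_zero (x : Fin 4 → A) : quat x 0 0 = x 0 - Complex.I • x 3 := by
  rw [quat_apply]
  simp [Fin.sum_univ_four, quatUnit, sub_eq_add_neg]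

theorem quat_zero_one (x : Fin 4 → A) : quat x 0 1 = -(Complex.I • x 1) - x 2 := by
  rw [quat_apply]
  simp [Fin.sum_univ_four, quatUnit, sub_eq_add_neg]

theorem quat_one_zero (x : Fin 4 → A) : quat x 1 0 = -(Complex.I • x 1) + x 2 := by
  rw [quat_apply]
  simp [Fin.sum_univ_four, quatUnit]

theorem quat_one_one (x : Fin 4 → A) : quat x 1 1 = x 0 + Complex.I • x 3 := by
  rw [quat_apply]
  simp [Fin.sum_univ_four, quatUnit]

theorem quatCoord_apply (M : Matrix (Fin 2) (Fin 2) A) :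
    quatCoord M = ![(1 / 2 : ℂ) • (M 0 0 + M 1 1),
      Complex.I • ((1 / 2 : ℂ) • (M 0 1 + M 1 0)), (1 / 2 : ℂ) • (M 1 0 - M 0 1),
      Complex.I • ((1 / 2 : ℂ) • (M 0 0 - M 1 1))] := by
  funext m
  fin_cases m <;>
    simp [quatCoord, quatUnit, Fin.sum_univ_two] <;> module

theorem quat_quatCoord (M : Matrix (Fin 2) (Fin 2) A) : quat (quatCoord M) = M := by
  ext i j
  fin_cases i <;> fin_cases j
  all_goals simp only [Fin.zero_eta, Fin.mk_one, quat_zero_zero, quat_zero_one, quat_one_zero,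
    quat_one_one, quatCoord_apply, Fin.isValue, Matrix.cons_val, I_smul_I_smul]
  all_goals module

theorem commute_quat {x : Fin 4 → A} (hc : ∀ l m, x l * x m = x m * x l) (i j k l : Fin 2) :
    Commute (quat x i j) (quat x k l) := by
  rw [quat_apply, quat_apply]
  exact Commute.sum_left _ _ _ fun m _ => Commute.sum_right _ _ _ fun n _ =>
    ((show Commute (x m) (x n) from hc m n).smul_left _).smul_right _

theorem quat_det {x : Fin 4 → A} (hc : ∀ l m, x l * x m = x m * x l) :
    quat x 0 0 * quat x 1 1 - quat x 0 1 * quat x 1 0 = ∑ m, x m ^ 2 := by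
  simp only [quat_zero_zero, quat_zero_one, quat_one_zero, quat_one_one, Fin.sum_univ_four,
    sub_mul, mul_add, smul_sub, smul_neg, neg_mul, mul_neg, smul_mul_assoc, mul_smul_comm, I_smul_I_smul,
    hc 3 0, hc 2 1, pow_two]
  module

variable [StarRing A] [StarModule ℂ A]

/-- The right-hand side is the adjugate. With commuting entries the product with `quat x` is
therefore the scalar determinant computed in `quat_det`. -/
theorem quat_conjTranspose {x : Fin 4 → A} (hx : ∀ m, star (x m) = x m) :
    (quat x).conjTranspose = !![quat x 1 1, -quat x 0 1; -quat x 1 0, quat x 0 0] := by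
  ext i j
  fin_cases i <;> fin_cases j <;>
    simp [Matrix.conjTranspose_apply, quat_zero_zero, quat_zero_one, quat_one_zero, quat_one_one,
      star_add, star_smul, hx, sub_eq_add_neg, add_comm]

theorem quat_mul_conjTranspose {x : Fin 4 → A} (hx : ∀ m, star (x m) = x m)
    (hc : ∀ l m, x l * x m = x m * x l) :
    quat x * (quat x).conjTranspose = Matrix.scalar (Fin 2) (∑ m, x m ^ 2) := by
  have h1 := quat_det hc
  have c := commute_quat hc
  rw [quat_conjTranspose hx]
  ext i j
  fin_cases i <;> fin_cases j <;>
    simp [Matrix.mul_apply, Fin.sum_univ_two, ← h1]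
  · abel
  · rw [(c 0 0 0 1).eq]; abel
  · rw [(c 1 0 1 1).eq]; abel
  · rw [(c 1 0 0 1).eq, (c 1 1 0 0).eq]; abel

theorem quat_conjTranspose_mul {x : Fin 4 → A} (hx : ∀ m, star (x m) = x m)
    (hc : ∀ l m, x l * x m = x m * x l) :
    (quat x).conjTranspose * quat x = Matrix.scalar (Fin 2) (∑ m, x m ^ 2) := by
  have h1 := quat_det hc
  have c := commute_quat hc
  rw [quat_conjTranspose hx]
  ext i j
  fin_cases i <;> fin_cases j <;>
    simp [Matrix.mul_apply, Fin.sum_univ_two, ← h1]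
  · rw [(c 1 1 0 0).eq]; abel
  · rw [(c 1 1 0 1).eq]; abel
  · rw [(c 1 0 0 0).eq]; abel
  · rw [(c 1 0 0 1).eq]; abel

end Quat

variable (R : DefTensor)

theorem QuadAlg.x₁_comm (l m : Fin 4) : x₁ R l * x₁ R m = x₁ R m * x₁ R l := by
  have h := RingQuot.mkAlgHom_rel ℂ (QuadRel.one_one (R := R) l m)
  rwa [map_mul, map_mul] at h

theorem QuadAlg.x₂_comm (a b : Fin 4) : x₂ R a * x₂ R b = x₂ R b * x₂ R a := by
  have h := RingQuot.mkAlgHom_rel ℂ (QuadRel.two_two (R := R) a b)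
  rwa [map_mul, map_mul] at h

theorem QuadAlg.x₁_mul_x₂ (l a : Fin 4) :
    x₁ R l * x₂ R a = ∑ b, ∑ m, R l a b m • (x₂ R b * x₁ R m) := by
  have h := RingQuot.mkAlgHom_rel ℂ (QuadRel.one_two (R := R) l a)
  simp only [map_mul, map_sum, map_smul] at h
  exact h

theorem S7.x₁_comm (l m : Fin 4) : x₁ R l * x₁ R m = x₁ R m * x₁ R l := by
  rw [x₁, x₁, ← map_mul, QuadAlg.x₁_comm, map_mul]

theorem S7.x₂_comm (a b : Fin 4) : x₂ R a * x₂ R b = x₂ R b * x₂ R a := by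
  rw [x₂, x₂, ← map_mul, QuadAlg.x₂_comm, map_mul]

theorem S7.x₁_mul_x₂ (l a : Fin 4) :
    x₁ R l * x₂ R a = ∑ b, ∑ m, R l a b m • (x₂ R b * x₁ R m) := by
  rw [x₁, x₂, ← map_mul, QuadAlg.x₁_mul_x₂]
  simp only [map_mul, map_sum, map_smul]
  rfl

theorem S7.sphere : ∑ l, x₁ R l ^ 2 + ∑ a, x₂ R a ^ 2 = 1 := by
  have h := RingQuot.mkAlgHom_rel ℂ (show SphereRel R _ _ from ⟨rfl, rfl⟩)
  simp only [map_add, map_sum, map_pow, map_one] at h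
  exact h

theorem ket_isometry : (ket R).conjTranspose * ket R = 1 := by
  rw [ket, Matrix.conjTranspose_fromRows_eq_fromCols_conjTranspose, Matrix.fromCols_mul_fromRows,
    quat_conjTranspose_mul (S7.star_x₂ R) (S7.x₂_comm R),
    quat_conjTranspose_mul (S7.star_x₁ R) (S7.x₁_comm R), ← map_add, add_comm, S7.sphere, map_one]

theorem quat_Y7 : quat (Y7 R) = (2 : ℂ) • (quat (S7.x₂ R) * (quat (S7.x₁ R)).conjTranspose) :=
  quat_quatCoord _

theorem S4.Y_map_val : (S4.Y R).map Subtype.val = quat (Y7 R) := by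
  ext i j
  simp only [S4.Y, quat_apply, Matrix.map_apply]
  rw [AddSubmonoidClass.coe_finsetSum]
  rfl

theorem S4.proj_map_val :
    (S4.proj R).map Subtype.val = ket R * (ket R).conjTranspose := by
  rw [ket, Matrix.conjTranspose_fromRows_eq_fromCols_conjTranspose, Matrix.fromRows_mul_fromCols,
    quat_mul_conjTranspose (S7.star_x₂ R) (S7.x₂_comm R),
    quat_mul_conjTranspose (S7.star_x₁ R) (S7.x₁_comm R)]
  have h12 : quat (S7.x₂ R) * (quat (S7.x₁ R)).conjTranspose =
      (1 / 2 : ℂ) • (S4.Y R).map Subtype.val := by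
    rw [S4.Y_map_val, quat_Y7, smul_smul]
    norm_num
  have h21 : quat (S7.x₁ R) * (quat (S7.x₂ R)).conjTranspose =
      (1 / 2 : ℂ) • (S4.Y R).conjTranspose.map Subtype.val := by
    have : (S4.Y R).conjTranspose.map Subtype.val =
        ((S4.Y R).map Subtype.val).conjTranspose := rfl
    rw [this, S4.Y_map_val, quat_Y7, Matrix.conjTranspose_smul, Matrix.conjTranspose_mul,
      Matrix.conjTranspose_conjTranspose, smul_smul]
    simp
  have hs := S7.sphere R
  have h1 : (1 / 2 : ℂ) • (1 + Y74 R) = ∑ a, S7.x₂ R a ^ 2 := by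
    rw [Y74, ← hs]; module
  have h2 : (1 / 2 : ℂ) • (1 - Y74 R) = ∑ a, S7.x₁ R a ^ 2 := by
    rw [Y74, ← hs]; module
  rw [h12, h21, ← h1, ← h2]
  ext (i | i) (j | j)
  · by_cases h : i = j
    · subst h; simp [S4.proj]; rfl
    · simp [S4.proj, h]
  · rfl
  · rfl
  · by_cases h : i = j
    · subst h; simp [S4.proj]; rfl
    · simp [S4.proj, h]

theorem S4.map_val_injective {m n : Type*} {M N : Matrix m n (S4 R)}
    (h : M.map Subtype.val = N.map Subtype.val) : M = N :=
  Matrix.map_injective Subtype.val_injective h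

theorem S4.proj_conjTranspose : (S4.proj R).conjTranspose = S4.proj R := by
  apply S4.map_val_injective
  have : (S4.proj R).conjTranspose.map Subtype.val =
    ((S4.proj R).map Subtype.val).conjTranspose := rfl
  rw [this, S4.proj_map_val, Matrix.conjTranspose_mul, Matrix.conjTranspose_conjTranspose]

theorem S4.proj_mul_self : S4.proj R * S4.proj R = S4.proj R := by
  apply S4.map_val_injective
  have : (S4.proj R * S4.proj R).map Subtype.val =
      (S4.proj R).map Subtype.val * (S4.proj R).map Subtype.val :=
    Matrix.map_mul (f := (S4 R).subtype)
  rw [this, S4.proj_map_val, Matrix.mul_assoc, ← Matrix.mul_assoc _ (ket R), ket_isometry,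
    Matrix.one_mul]

theorem S4.two_proj_sub_one :
    (2 : ℂ) • S4.proj R - 1 = reflMatrix (S4.y4 R) (S4.Y R) (S4.Y R).conjTranspose := by
  rw [S4.proj, smul_smul, reflMatrix]
  norm_num
  ext1 (i | i) (j | j)
  · by_cases h : i = j
    · subst h; simp
    · simp [h]
  · simp
  · simp
  · by_cases h : i = j
    · subst h; simp
    · simp [h]

theorem S4.reflMatrix_sq :
    reflMatrix (S4.y4 R) (S4.Y R) (S4.Y R).conjTranspose *
      reflMatrix (S4.y4 R) (S4.Y R) (S4.Y R).conjTranspose = 1 := by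
  rw [← S4.two_proj_sub_one, sub_mul, mul_sub, mul_one, one_mul, smul_mul_smul_comm,
    S4.proj_mul_self]
  module

theorem S3.star_mk (x : S4 R) : star (mk R x) = mk R (star x) :=
  star_mkAlgHom (S4.EquatorRel R) (S4.EquatorRel.star_rel R) x

theorem S3.mk_y4 : mk R (S4.y4 R) = 0 := by
  have h := RingQuot.mkAlgHom_rel ℂ (show S4.EquatorRel R _ _ from ⟨rfl, rfl⟩)
  rwa [map_zero] at h

theorem S3.Y_conjTranspose : (Y R).conjTranspose = (S4.Y R).conjTranspose.map (mk R) := by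
  ext i j
  exact S3.star_mk R _

/-- These are the diagonal blocks of `q * q = 1` once `y4` is set to zero. -/
theorem S3.Y_unitary : Y R * (Y R).conjTranspose = 1 ∧ (Y R).conjTranspose * Y R = 1 := by
  have h := S4.reflMatrix_sq R
  rw [reflMatrix, Matrix.fromBlocks_multiply, ← Matrix.fromBlocks_one] at h
  obtain ⟨h1, -, -, h2⟩ := Matrix.fromBlocks_inj.1 h
  have hs : ∀ y : S4 R, mk R y = 0 → (Matrix.scalar (Fin 2) y).map (mk R) = 0 := by
    intro y hy
    ext i j
    by_cases hij : i = j
    · subst hij; simp [hy]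
    · simp [hij]
  have h1' := congrArg (fun M : Matrix (Fin 2) (Fin 2) (S4 R) => M.map (mk R)) h1
  have h2' := congrArg (fun M : Matrix (Fin 2) (Fin 2) (S4 R) => M.map (mk R)) h2
  simp only [Matrix.map_add _ (map_add (mk R)), Matrix.map_mul, hs _ (S3.mk_y4 R),
    hs (-S4.y4 R) (by rw [map_neg, S3.mk_y4, neg_zero]), mul_zero, zero_add, add_zero,
    Matrix.map_one _ (map_zero (mk R)) (map_one (mk R))] at h1' h2'
  rw [S3.Y_conjTranspose]
  exact ⟨h1', h2'⟩

theorem chEven_zero_proj : chEven 0 (S4.proj R) = 0 := by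
  rw [chEven_eq, S4.two_proj_sub_one, traceTensor_eq_sum, sum_fin_succ_arrow]
  have h : ∀ y : S4 R, elem (S4 R) 0 (fun _ => -y) = -elem (S4 R) 0 (fun _ => y) := by
    intro y
    have := (elem (S4 R) 0).map_update_smul (fun _ => y) 0 (-1) y
    rw [neg_one_smul, neg_one_smul] at this
    have hu : ∀ z : S4 R, Function.update (fun _ : Fin 1 => y) 0 z = fun _ => z := fun z => by
      funext k; fin_cases k; rfl
    rwa [hu, hu] at this
  have e : ∀ i : Fin 2 ⊕ Fin 2, ∑ j : Fin 0 → Fin 2 ⊕ Fin 2,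
      elem (S4 R) (2 * 0) (fun k => reflMatrix (S4.y4 R) (S4.Y R) (S4.Y R).conjTranspose
        ((Matrix.vecCons i j : Fin 1 → _) k) ((Matrix.vecCons i j : Fin 1 → _) (k + 1))) =
      elem (S4 R) 0 (fun _ => reflMatrix (S4.y4 R) (S4.Y R) (S4.Y R).conjTranspose i i) := by
    intro i
    rw [sum_fin_zero_arrow]
    congr 1
    funext k
    fin_cases k
    rfl
  rw [Fintype.sum_congr _ _ e]
  simp [reflMatrix, h]

end

/-! ### Consequences of the Yang-Baxter equation for `R`. -/

section

open Hochschild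

section Braid

variable {J : Type} [DecidableEq J] [Fintype J] (S : Matrix (J × J) (J × J) ℂ)

theorem leg_braid_left (a b c a' b' c' : J) :
    (leg₁₂ S * leg₂₃ S * leg₁₂ S) (a, b, c) (a', b', c') =
      ∑ x, ∑ z, ∑ y, S (a, b) (x, y) * S (y, c) (z, c') * S (x, z) (a', b') := by
  simp only [Matrix.mul_apply, leg₁₂, leg₂₃, Fintype.sum_prod_type, Finset.sum_mul, mul_ite, ite_mul,
    mul_one, one_mul, mul_zero, zero_mul]
  simp [Finset.sum_ite_eq]

theorem leg_braid_right (a b c a' b' c' : J) :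
    (leg₂₃ S * leg₁₂ S * leg₂₃ S) (a, b, c) (a', b', c') =
      ∑ w, ∑ z, ∑ y, S (b, c) (y, z) * S (a, y) (a', w) * S (w, z) (b', c') := by
  simp only [Matrix.mul_apply, leg₁₂, leg₂₃, Fintype.sum_prod_type, Finset.sum_mul, mul_ite, ite_mul,
    mul_one, one_mul, mul_zero, zero_mul]
  simp [Finset.sum_ite_eq]

end Braid

variable {R : DefTensor}

/-- The Yang-Baxter component that moves one `x₁` past two `x₂`. It says that the matrices `(R l a b
m)` in the indices `l`, `m` commute for all pairs `(a, b)`. -/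
theorem IsDeformation.comm_upper (hR : IsDeformation R) (l a b a' b' n : Fin 4) :
    ∑ m, R l a b m * R m a' b' n = ∑ m, R l a' b' m * R m a b n := by
  have h := congrFun (congrFun hR.yangBaxter (Sum.inl l, Sum.inr a, Sum.inr a'))
    (Sum.inr b', Sum.inr b, Sum.inl n)
  rw [leg_braid_left, leg_braid_right] at h
  simp only [Fintype.sum_sum_type, bigR, mul_zero, zero_mul, Finset.sum_const_zero, add_zero,
    zero_add, mul_ite, ite_mul, mul_one, one_mul, ite_and] at h
  simpa [Finset.sum_ite_eq] using h

/-- The companion component, moving two `x₁` past one `x₂`; it makes the operators `lower` commute.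
-/
theorem IsDeformation.comm_lower (hR : IsDeformation R) (l l' a c k k' : Fin 4) :
    ∑ b, R l a b k * R l' b c k' = ∑ b, R l' a b k' * R l b c k := by
  have h := congrFun (congrFun hR.yangBaxter (Sum.inl l, Sum.inl l', Sum.inr a))
    (Sum.inr c, Sum.inl k', Sum.inl k)
  rw [leg_braid_left, leg_braid_right] at h
  simp only [Fintype.sum_sum_type, bigR, mul_zero, zero_mul, Finset.sum_const_zero, add_zero,
    zero_add, mul_ite, ite_mul, mul_one, one_mul, ite_and] at h
  simpa [Finset.sum_ite_eq] using h

end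

section

open Hochschild

/-! ### Polynomials in four commuting variables, with lifts to noncommutative algebras -/

/-- Commutation of the generators of a free algebra. -/
inductive CommRel : FreeAlgebra ℂ (Fin 4) → FreeAlgebra ℂ (Fin 4) → Prop
  | comm (a b : Fin 4) : CommRel (FreeAlgebra.ι ℂ a * FreeAlgebra.ι ℂ b)
      (FreeAlgebra.ι ℂ b * FreeAlgebra.ι ℂ a)

/-- The algebra of polynomials in four variables, presented by generators and relations. -/
abbrev Poly : Type := RingQuot CommRel

namespace Poly

/-- The variables. -/
def X (a : Fin 4) : Poly := RingQuot.mkAlgHom ℂ CommRel (FreeAlgebra.ι ℂ a)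

theorem X_comm (a b : Fin 4) : X a * X b = X b * X a := by
  have h := RingQuot.mkAlgHom_rel ℂ (CommRel.comm a b)
  rwa [map_mul, map_mul] at h

variable {B : Type u} [Ring B] [Algebra ℂ B]

/-- The homomorphism determined by four commuting elements. -/
def lift (f : Fin 4 → B) (hf : ∀ a b, f a * f b = f b * f a) : Poly →ₐ[ℂ] B :=
  RingQuot.liftAlgHom ℂ ⟨FreeAlgebra.lift ℂ f, by
    rintro _ _ ⟨a, b⟩
    simp [hf a b]⟩

theorem lift_X (f : Fin 4 → B) (hf : ∀ a b, f a * f b = f b * f a) (a : Fin 4) :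
    lift f hf (X a) = f a := by
  rw [lift, X, RingQuot.liftAlgHom_mkAlgHom_apply, FreeAlgebra.lift_ι_apply]

theorem induction {motive : Poly → Prop} (one : motive 1)
    (X_mul : ∀ a p, motive p → motive (X a * p)) (smul : ∀ (c : ℂ) p, motive p → motive (c • p))
    (add : ∀ p q, motive p → motive q → motive (p + q)) (p : Poly) : motive p := by
  obtain ⟨p, rfl⟩ := RingQuot.mkAlgHom_surjective ℂ CommRel p
  -- Multiplying into an arbitrary `q` makes the product case compose, so that only left
  -- multiplication by a variable has to be assumed.
  suffices h : ∀ q, motive q → motive (RingQuot.mkAlgHom ℂ CommRel p * q) by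
    simpa using h 1 one
  induction p using FreeAlgebra.induction with
  | grade0 c =>
    intro q hq
    rw [AlgHom.commutes, ← Algebra.smul_def]
    exact smul c q hq
  | grade1 x => exact fun q hq => X_mul x q hq
  | mul a b ha hb =>
    intro q hq
    rw [map_mul, mul_assoc]
    exact ha _ (hb _ hq)
  | add a b ha hb =>
    intro q hq
    rw [map_add, add_mul]
    exact add _ _ (ha _ hq) (hb _ hq)

end Poly

theorem sum_rotate {α : Type u} {β : Type v} {γ : Type w} [Fintype α] [Fintype β] [Fintype γ]
    {W : Type*} [AddCommMonoid W] (F : α → β → γ → W) :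
    ∑ a, ∑ b, ∑ c, F a b c = ∑ b, ∑ c, ∑ a, F a b c := by
  rw [Finset.sum_comm]
  exact Finset.sum_congr rfl fun _ _ => Finset.sum_comm

/-! ### The representation of `𝒜_R` induced from a character of the `x₁`. -/

namespace IsDeformation

variable {R : DefTensor} (hR : IsDeformation R) (ξ : Fin 4 → ℂ)

/-- The homomorphism `x₂^a ↦ (R^{l a}_{b m} x₂^b)_{l m}` implementing the commutation of `x₁`
past polynomials in `x₂`. -/
def twist : Poly →ₐ[ℂ] Matrix (Fin 4) (Fin 4) Poly :=
  Poly.lift (fun a => Matrix.of fun l m => ∑ b, R l a b m • Poly.X b) (by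
    have key : ∀ (a a' l n : Fin 4), ∑ m, (∑ b, R l a b m • Poly.X b) *
        (∑ b, R m a' b n • Poly.X b) =
        ∑ b, ∑ b', (∑ m, R l a b m * R m a' b' n) • (Poly.X b * Poly.X b') := by
      intro a a' l n
      simp only [Finset.sum_mul, Finset.mul_sum, smul_mul_smul_comm, Finset.sum_smul]
      rw [Finset.sum_comm]
      conv_rhs => rw [Finset.sum_comm]
      refine Finset.sum_congr rfl fun b _ => ?_
      rw [Finset.sum_comm]
    intro a a'
    ext l n
    simp only [Matrix.mul_apply, Matrix.of_apply]
    rw [key, key, Finset.sum_comm]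
    refine Finset.sum_congr rfl fun b _ => Finset.sum_congr rfl fun b' _ => ?_
    rw [hR.comm_upper, Poly.X_comm])

theorem twist_X_apply (a l m : Fin 4) :
    hR.twist (Poly.X a) l m = ∑ b, R l a b m • Poly.X b := by
  rw [twist, Poly.lift_X, Matrix.of_apply]

/-- The action of `x₁^l` on polynomials in `x₂`, induced from the character `ξ` of the algebra of
polynomials in `x₁`. -/
def lower (l : Fin 4) : Poly →ₗ[ℂ] Poly :=
  ∑ m, ξ m • (Matrix.entryLinearMap ℂ Poly l m ∘ₗ hR.twist.toLinearMap)

theorem lower_apply (l : Fin 4) (f : Poly) : hR.lower ξ l f = ∑ m, ξ m • hR.twist f l m := by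
  simp [lower]

theorem lower_one (l : Fin 4) : hR.lower ξ l 1 = ξ l • (1 : Poly) := by
  rw [lower_apply, map_one]
  simp [Matrix.one_apply]

/-- The commutation relation of `x₁` with `x₂` as an identity of operators, obtained from
multiplicativity of `twist`. -/
theorem lower_X_mul (l a : Fin 4) (f : Poly) :
    hR.lower ξ l (Poly.X a * f) = ∑ b, ∑ k, R l a b k • (Poly.X b * hR.lower ξ k f) := by
  simp only [lower_apply, map_mul, Matrix.mul_apply, twist_X_apply, Finset.sum_mul,
    Finset.mul_sum, Finset.smul_sum, smul_mul_assoc, mul_smul_comm]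
  rw [Finset.sum_comm]
  conv_rhs => rw [Finset.sum_comm]
  refine Finset.sum_congr rfl fun k _ => ?_
  rw [Finset.sum_comm]
  refine Finset.sum_congr rfl fun b _ => Finset.sum_congr rfl fun m _ => ?_
  rw [smul_comm]

theorem lower_comm (l l' : Fin 4) (f : Poly) :
    hR.lower ξ l (hR.lower ξ l' f) = hR.lower ξ l' (hR.lower ξ l f) := by
  induction f using Poly.induction generalizing l l' with
  | one => simp only [lower_one, map_smul, smul_smul, mul_comm]
  | smul c p h => simp only [map_smul, h l l']
  | add p q hp hq => simp only [map_add, hp l l', hq l l']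
  | X_mul a p h =>
    have key : ∀ l l' : Fin 4, hR.lower ξ l (hR.lower ξ l' (Poly.X a * p)) =
        ∑ c, ∑ k, ∑ k', (∑ b, R l' a b k' * R l b c k) •
          (Poly.X c * hR.lower ξ k (hR.lower ξ k' p)) := by
      intro l l'
      simp only [lower_X_mul, map_sum, map_smul, Finset.smul_sum, smul_smul, Finset.sum_smul]
      refine (Finset.sum_congr rfl fun b _ => sum_rotate _).trans ?_
      exact (sum_rotate _).trans
        (Finset.sum_congr rfl fun c _ => Finset.sum_congr rfl fun k _ => Finset.sum_comm)
    rw [key, key]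
    refine Finset.sum_congr rfl fun c _ => ?_
    rw [Finset.sum_comm]
    refine Finset.sum_congr rfl fun k _ => Finset.sum_congr rfl fun k' _ => ?_
    rw [hR.comm_lower, h]

/-- The operators by which the generators act on polynomials in `x₂`. -/
def repFree : FreeStarAlgebra (Fin 4 ⊕ Fin 4) →ₐ[ℂ] Module.End ℂ Poly :=
  (FreeAlgebra.lift ℂ (Sum.elim (hR.lower ξ) fun a => LinearMap.mulLeft ℂ (Poly.X a)) :
    FreeAlgebra ℂ (Fin 4 ⊕ Fin 4) →ₐ[ℂ] Module.End ℂ Poly)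

theorem repFree_inl (l : Fin 4) :
    hR.repFree ξ (FreeStarAlgebra.gen (Sum.inl l)) = hR.lower ξ l :=
  FreeAlgebra.lift_ι_apply (A := Module.End ℂ Poly) _ _

theorem repFree_inr (a : Fin 4) :
    hR.repFree ξ (FreeStarAlgebra.gen (Sum.inr a)) = LinearMap.mulLeft ℂ (Poly.X a) :=
  FreeAlgebra.lift_ι_apply (A := Module.End ℂ Poly) _ _

theorem repFree_rel {x y : FreeStarAlgebra (Fin 4 ⊕ Fin 4)} (h : QuadRel R x y) :
    hR.repFree ξ x = hR.repFree ξ y := by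
  cases h with
  | one_one l m =>
    rw [map_mul, map_mul, repFree_inl, repFree_inl]
    exact LinearMap.ext fun f => hR.lower_comm ξ l m f
  | two_two a b =>
    rw [map_mul, map_mul, repFree_inr, repFree_inr]
    refine LinearMap.ext fun f => ?_
    simp only [Module.End.mul_apply, LinearMap.mulLeft_apply, ← mul_assoc, Poly.X_comm a b]
  | one_two l a =>
    simp only [map_sum, map_smul, map_mul, repFree_inl, repFree_inr]
    refine LinearMap.ext fun f => ?_
    simp [lower_X_mul]
  | two_one l a =>
    simp only [map_sum, map_smul, map_mul, repFree_inl, repFree_inr]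
    refine LinearMap.ext fun f => ?_
    simp only [Module.End.mul_apply, LinearMap.mulLeft_apply, LinearMap.sum_apply,
      LinearMap.smul_apply, lower_X_mul, Finset.smul_sum, smul_smul]
    refine Eq.trans ?_ ((Finset.sum_congr rfl fun b _ => sum_rotate _).trans (sum_rotate _)).symm
    -- Reordering by the conjugate tensor and then by `R` is the identity; this is the reality
    -- condition.
    simp only [← Finset.sum_smul, hR.reality, ite_smul, one_smul, zero_smul, ite_and]
    simp

/-- The representation of `𝒜_R` on polynomials in `x₂`. -/
def rep : QuadAlg R →ₐ[ℂ] Module.End ℂ Poly :=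
  RingQuot.liftAlgHom ℂ ⟨hR.repFree ξ, fun _ _ h => hR.repFree_rel ξ h⟩

theorem rep_x₁ (l : Fin 4) : hR.rep ξ (QuadAlg.x₁ R l) = hR.lower ξ l := by
  refine (RingQuot.liftAlgHom_mkAlgHom_apply ..).trans ?_
  exact hR.repFree_inl ξ l

theorem rep_x₂ (a : Fin 4) : hR.rep ξ (QuadAlg.x₂ R a) = LinearMap.mulLeft ℂ (Poly.X a) := by
  refine (RingQuot.liftAlgHom_mkAlgHom_apply ..).trans ?_
  exact hR.repFree_inr ξ a

/-- Normal ordering followed by evaluation at `x₁ = ξ`, `x₂ = η`. -/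
theorem exists_normalOrderEval (hR : IsDeformation R) (ξ η : Fin 4 → ℂ) : ∃ φ : QuadAlg R →ₗ[ℂ] ℂ, φ 1 = 1 ∧
    (∀ a u, φ (QuadAlg.x₂ R a * u) = η a * φ u) ∧
    (∀ l u, φ (u * QuadAlg.x₁ R l) = ξ l * φ u) := by
  -- The element acts on the vacuum `1`, an eigenvector of every `x₁` with eigenvalue `ξ`, and the
  -- resulting polynomial is evaluated at `η`.
  refine ⟨(Poly.lift η fun a b => mul_comm _ _).toLinearMap ∘ₗ
    LinearMap.applyₗ (1 : Poly) ∘ₗ (hR.rep ξ).toLinearMap, ?_, fun a u => ?_, fun l u => ?_⟩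
  · simp
  · simp [rep_x₂, Poly.lift_X]
  · simp [rep_x₁, lower_one]

end IsDeformation

end

section

open Hochschild

/-! ### Linear functionals on the spheres -/

theorem ringQuot_exists_factor {B : Type u} [Ring B] [Algebra ℂ B] (r : B → B → Prop)
    (φ : B →ₗ[ℂ] ℂ) (h : ∀ a b, r a b → ∀ u v, φ (u * a * v) = φ (u * b * v)) :
    -- As `φ` is only linear, the universal property for algebra maps does not apply; `φ` is shown
    -- to be constant on the classes of the generated congruence.
    ∃ ψ : RingQuot r →ₗ[ℂ] ℂ, ∀ x, ψ (RingQuot.mkAlgHom ℂ r x) = φ x := by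
  have hrel : ∀ a b, RingQuot.Rel r a b → ∀ u v, φ (u * a * v) = φ (u * b * v) := by
    intro a b hab
    induction hab with
    | of hab => exact h _ _ hab
    | add_left _ ih => intro u v; simp only [mul_add, add_mul, map_add, ih]
    | mul_left _ ih => intro u v; simp only [mul_assoc] at ih ⊢; exact ih _ _
    | mul_right _ ih => intro u v; simp only [← mul_assoc] at ih ⊢; exact ih _ _
  have heq : ∀ a b, RingQuot.mkAlgHom ℂ r a = RingQuot.mkAlgHom ℂ r b → φ a = φ b := by
    intro a b hab
    simp only [RingQuot.mkAlgHom_def, RingQuot.mkRingHom_def] at hab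
    have h1 : Quot.mk (RingQuot.Rel r) a = Quot.mk (RingQuot.Rel r) b :=
      congrArg RingQuot.toQuot hab
    have h2 := Quot.eqvGen_exact h1
    clear h1 hab
    induction h2 with
    | rel _ _ hxy => simpa using hrel _ _ hxy 1 1
    | refl _ => rfl
    | symm _ _ _ ih => exact ih.symm
    | trans _ _ _ _ _ ih1 ih2 => exact ih1.trans ih2
  have hs := RingQuot.mkAlgHom_surjective ℂ r
  refine ⟨{ toFun := fun x => φ (hs x).choose, map_add' := fun x y => ?_,
            map_smul' := fun c x => ?_ }, fun x => heq _ _ (hs _).choose_spec⟩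
  · rw [← map_add]
    exact heq _ _ (by rw [map_add, (hs _).choose_spec, (hs _).choose_spec, (hs _).choose_spec])
  · rw [RingHom.id_apply, ← map_smul]
    exact heq _ _ (by rw [map_smul, (hs _).choose_spec, (hs _).choose_spec])

namespace IsDeformation

variable {R : DefTensor}

theorem x₁_sq_comm (hR : IsDeformation R) (u : S7 R) :
    (∑ l, S7.x₁ R l ^ 2) * u = u * ∑ l, S7.x₁ R l ^ 2 := by
  obtain ⟨u, rfl⟩ := RingQuot.mkAlgHom_surjective ℂ (SphereRel R) u
  have h := congrArg (S7.mk R) (Subalgebra.mem_center_iff.1 hR.central₁ u)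
  simp only [map_mul, map_sum, map_pow] at h
  exact h.symm

theorem x₂_sq_comm (hR : IsDeformation R) (u : S7 R) :
    (∑ l, S7.x₂ R l ^ 2) * u = u * ∑ l, S7.x₂ R l ^ 2 := by
  obtain ⟨u, rfl⟩ := RingQuot.mkAlgHom_surjective ℂ (SphereRel R) u
  have h := congrArg (S7.mk R) (Subalgebra.mem_center_iff.1 hR.central₂ u)
  simp only [map_mul, map_sum, map_pow] at h
  exact h.symm

theorem Y74_comm (hR : IsDeformation R) (u : S7 R) : Y74 R * u = u * Y74 R := by
  rw [Y74, sub_mul, mul_sub, hR.x₁_sq_comm, hR.x₂_sq_comm]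

theorem exists_sphereEval (hR : IsDeformation R) {ξ η : Fin 4 → ℂ}
    (h : ∑ l, ξ l ^ 2 + ∑ a, η a ^ 2 = 1) : ∃ φ : S7 R →ₗ[ℂ] ℂ, φ 1 = 1 ∧
    (∀ a u, φ (S7.x₂ R a * u) = η a * φ u) ∧ (∀ l u, φ (u * S7.x₁ R l) = ξ l * φ u) ∧
    ∀ u, φ (Y74 R * u) = (∑ a, η a ^ 2 - ∑ l, ξ l ^ 2) * φ u := by
  obtain ⟨φ, h1, h2, h3⟩ := hR.exists_normalOrderEval ξ η
  have hx₁ : ∀ u, φ (u * ∑ l, QuadAlg.x₁ R l ^ 2) = (∑ l, ξ l ^ 2) * φ u := by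
    intro u
    simp only [Finset.mul_sum, map_sum, pow_two, ← mul_assoc, h3, Finset.sum_mul]
  have hx₂ : ∀ u, φ ((∑ a, QuadAlg.x₂ R a ^ 2) * u) = (∑ a, η a ^ 2) * φ u := by
    intro u
    simp only [Finset.sum_mul, map_sum, pow_two, mul_assoc, h2]
  obtain ⟨ψ, hψ'⟩ : ∃ ψ : S7 R →ₗ[ℂ] ℂ, ∀ x, ψ (S7.mk R x) = φ x :=
    ringQuot_exists_factor (SphereRel R) φ (by
    rintro _ _ ⟨rfl, rfl⟩ u v
    have e1 := Subalgebra.mem_center_iff.1 hR.central₁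
    have e2 := Subalgebra.mem_center_iff.1 hR.central₂
    -- Centrality moves `(x₁)²` to the far right and `(x₂)²` to the far left, where `φ` evaluates
    -- them.
    rw [mul_add, add_mul, map_add, mul_assoc, ← e1, ← mul_assoc, hx₁, e2, mul_assoc, hx₂, ← add_mul,
      h, one_mul, mul_one])
  have hs : Function.Surjective (S7.mk R) := RingQuot.mkAlgHom_surjective ℂ (SphereRel R)
  have h2' : ∀ a u, ψ (S7.x₂ R a * u) = η a * ψ u := by
    intro a u
    obtain ⟨u, rfl⟩ := hs u
    rw [S7.x₂, ← map_mul, hψ', hψ', h2]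
  have h3' : ∀ l u, ψ (u * S7.x₁ R l) = ξ l * ψ u := by
    intro a u
    obtain ⟨u, rfl⟩ := hs u
    rw [S7.x₁, ← map_mul, hψ', hψ', h3]
  refine ⟨ψ, by rw [← map_one (S7.mk R), hψ', h1], h2', h3', fun u => ?_⟩
  rw [Y74, sub_mul, hR.x₁_sq_comm, map_sub, sub_mul]
  congr 1
  · simp only [Finset.sum_mul, map_sum, pow_two, mul_assoc, h2']
  · simp only [Finset.mul_sum, map_sum, pow_two, ← mul_assoc, h3', Finset.sum_mul]

/-- The difference of the evaluations at two points that differ by `ξ ↦ -ξ`. With `s ^ 2 = 1 / 2`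
both lie on the equator, so multiples of `Y⁴` are killed; `1` cancels, and the value on `x₂^b x₁^m`
is `2 s ^ 2 = 1`. -/
theorem exists_functional_coord (hR : IsDeformation R) (b m : Fin 4) :
    ∃ f : S7 R →ₗ[ℂ] ℂ, f 1 = 0 ∧ (∀ u, f (Y74 R * u) = 0) ∧
      ∀ b' m', f (S7.x₂ R b' * S7.x₁ R m') = if b' = b ∧ m' = m then 1 else 0 := by
  obtain ⟨s, hs⟩ := IsAlgClosed.exists_pow_nat_eq (1 / 2 : ℂ) (n := 2) (by norm_num)
  have hsum : ∀ (c : Fin 4) (t : ℂ), t ^ 2 = 1 / 2 → ∑ a, (Pi.single c t : Fin 4 → ℂ) a ^ 2 = 1 / 2 := by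
    intro c t ht
    rw [Finset.sum_eq_single c]
    · simpa using ht
    · intro a _ ha; simp [ha]
    · simp
  obtain ⟨φ, h1, h2, h3, h4⟩ := hR.exists_sphereEval
    (ξ := Pi.single m s) (η := Pi.single b s) (by rw [hsum _ _ hs, hsum _ _ hs]; norm_num)
  obtain ⟨φ', h1', h2', h3', h4'⟩ := hR.exists_sphereEval
    (ξ := Pi.single m (-s)) (η := Pi.single b s)
    (by rw [hsum _ _ hs, hsum _ _ (by rw [neg_sq, hs])]; norm_num)
  refine ⟨φ - φ', by simp [h1, h1'], fun u => ?_, fun b' m' => ?_⟩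
  · rw [LinearMap.sub_apply, h4, h4', hsum _ _ hs, hsum _ _ hs, hsum _ _ (by rw [neg_sq, hs])]
    simp
  · have e : ∀ u : S7 R, u = 1 * u := fun u => (one_mul u).symm
    rw [LinearMap.sub_apply, h2, h2', e (S7.x₁ R m'), h3, h3', h1, h1']
    by_cases hb : b' = b
    · by_cases hm : m' = m
      · subst hb hm
        simp only [Pi.single_eq_same, and_self, if_true]
        linear_combination 2 * hs
      · simp [hm]
    · simp [hb]

theorem exists_functional (hR : IsDeformation R) (C : Fin 2 → Fin 2 → Fin 2 → Fin 2 → ℂ) :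
    ∃ f : S7 R →ₗ[ℂ] ℂ, f 1 = 0 ∧ (∀ u, f (Y74 R * u) = 0) ∧
      ∀ k l i j, f (quat (S7.x₂ R) k l * quat (S7.x₁ R) i j) = C k l i j := by
  choose f h1 h2 h3 using hR.exists_functional_coord
  refine ⟨∑ b, ∑ m, quatCoord (Matrix.of fun k l => quatCoord (Matrix.of (C k l)) m) b • f b m,
    by simp [h1], fun u => by simp [h2], fun k l i j => ?_⟩
  have hx : ∀ b' m', (∑ b, ∑ m, quatCoord (Matrix.of fun k l =>
      quatCoord (Matrix.of (C k l)) m) b • f b m) (S7.x₂ R b' * S7.x₁ R m') =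
      quatCoord (Matrix.of fun k l => quatCoord (Matrix.of (C k l)) m') b' := by
    intro b' m'
    simp [h3, ite_and]
  rw [quat_apply, quat_apply]
  simp only [Finset.mul_sum, Finset.sum_mul, map_sum, smul_mul_smul_comm, map_smul, hx]
  have e1 : ∀ m, ∑ b, quatUnit b k l •
      quatCoord (Matrix.of fun k l => quatCoord (Matrix.of (C k l)) m) b =
      quatCoord (Matrix.of (C k l)) m := fun m => by
    rw [← quat_apply, quat_quatCoord, Matrix.of_apply]
  have e2 : ∑ m, quatUnit m i j • quatCoord (Matrix.of (C k l)) m = C k l i j := by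
    rw [← quat_apply, quat_quatCoord, Matrix.of_apply]
  rw [← e2]
  refine Finset.sum_congr rfl fun m _ => ?_
  rw [← e1, Finset.smul_sum]
  refine Finset.sum_congr rfl fun b _ => ?_
  rw [smul_smul, mul_comm]

end IsDeformation

end

section

open Hochschild

/-! ### Commutation relations between the entries of the quaternions -/

theorem diagonal_mem_specialUnitaryGroup :
    Matrix.diagonal ![(3 + 4 * Complex.I) / 5, (3 - 4 * Complex.I) / 5] ∈
      Matrix.specialUnitaryGroup (Fin 2) ℂ := by
  have hI : Complex.I ^ 2 = -1 := Complex.I_sq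
  rw [Matrix.mem_specialUnitaryGroup_iff, Matrix.mem_unitaryGroup_iff']
  refine ⟨?_, ?_⟩
  · ext i j
    fin_cases i <;> fin_cases j <;>
      simp [Matrix.mul_apply, Fin.sum_univ_two, Matrix.star_apply, map_ofNat] <;>
      linear_combination (-16 / 25 : ℂ) * hI
  · rw [Matrix.det_diagonal, Fin.prod_univ_two]
    simp only [Matrix.cons_val_zero, Matrix.cons_val_one]
    linear_combination (-16 / 25 : ℂ) * hI

theorem rotation_mem_specialUnitaryGroup :
    (!![3 / 5, 4 / 5; -4 / 5, 3 / 5] : Matrix (Fin 2) (Fin 2) ℂ) ∈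
      Matrix.specialUnitaryGroup (Fin 2) ℂ := by
  rw [Matrix.mem_specialUnitaryGroup_iff, Matrix.mem_unitaryGroup_iff']
  refine ⟨?_, ?_⟩
  · ext i j
    fin_cases i <;> fin_cases j <;>
      simp [Matrix.mul_apply, Fin.sum_univ_two, Matrix.star_apply, map_ofNat] <;> norm_num
  · rw [Matrix.det_fin_two_of]
    norm_num

/-- A tensor invariant under the diagonal action of `SU(2)` is a combination of the identity and
of the flip. -/
theorem invariant_tensor {d : Fin 2 → Fin 2 → Fin 2 → Fin 2 → ℂ}
    (h : ∀ w ∈ Matrix.specialUnitaryGroup (Fin 2) ℂ, ∀ j l l' j',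
      ∑ j₁, ∑ l₁, w j₁ j * w l₁ l * d j₁ l₁ l' j' =
        ∑ l₂, ∑ j₂, d j l l₂ j₂ * (w l' l₂ * w j' j₂)) (j l l' j' : Fin 2) :
    d j l l' j' = (if j = j' ∧ l = l' then d 0 1 1 0 else 0) +
      if j = l' ∧ l = j' then d 0 1 0 1 else 0 := by
  set t : Fin 2 → ℂ := ![(3 + 4 * Complex.I) / 5, (3 - 4 * Complex.I) / 5] with ht
  have hdiag : ∀ j l l' j', (t j * t l - t l' * t j') * d j l l' j' = 0 := by
    intro j l l' j'
    have := h _ diagonal_mem_specialUnitaryGroup j l l' j'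
    rw [← ht] at this
    simp only [Matrix.diagonal_apply, ite_mul, mul_ite, zero_mul, mul_zero, Finset.sum_ite_eq,
      Finset.sum_ite_eq', Finset.mem_univ, if_true] at this
    linear_combination this
  have hzero : ∀ j l l' j', (t j * t l - t l' * t j').re ≠ 0 ∨ (t j * t l - t l' * t j').im ≠ 0 →
      d j l l' j' = 0 := by
    intro j l l' j' hne
    refine (mul_eq_zero.1 (hdiag j l l' j')).resolve_left fun h0 => ?_
    rw [h0] at hne
    simp at hne
  -- `t 0 ^ 2`, `t 0 * t 1 = 1` and `t 1 ^ 2` are distinct, so the diagonal element kills the ten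
  -- components of nonzero weight. The rotation then relates the six surviving ones and leaves two
  -- free parameters.
  have e0001 : d 0 0 0 1 = 0 := hzero _ _ _ _ (Or.inl (by simp [t]; norm_num))
  have e0010 : d 0 0 1 0 = 0 := hzero _ _ _ _ (Or.inl (by simp [t]; norm_num))
  have e0011 : d 0 0 1 1 = 0 := hzero _ _ _ _ (Or.inr (by simp [t]; norm_num))
  have e1100 : d 1 1 0 0 = 0 := hzero _ _ _ _ (Or.inr (by simp [t]; norm_num))
  have e1101 : d 1 1 0 1 = 0 := hzero _ _ _ _ (Or.inl (by simp [t]; norm_num))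
  have e1110 : d 1 1 1 0 = 0 := hzero _ _ _ _ (Or.inl (by simp [t]; norm_num))
  have e0100 : d 0 1 0 0 = 0 := hzero _ _ _ _ (Or.inl (by simp [t]; norm_num))
  have e0111 : d 0 1 1 1 = 0 := hzero _ _ _ _ (Or.inl (by simp [t]; norm_num))
  have e1000 : d 1 0 0 0 = 0 := hzero _ _ _ _ (Or.inl (by simp [t]; norm_num))
  have e1011 : d 1 0 1 1 = 0 := hzero _ _ _ _ (Or.inl (by simp [t]; norm_num))
  have hrot := h _ rotation_mem_specialUnitaryGroup
  have r1 := hrot 0 0 0 1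
  have r2 := hrot 0 0 1 0
  have r3 := hrot 1 1 0 1
  have r4 := hrot 0 1 0 0
  simp only [Fin.sum_univ_two, Matrix.of_apply, Matrix.cons_val', Matrix.cons_val_zero,
    Matrix.cons_val_one, Matrix.cons_val_fin_one, e0001, e0010, e0011, e1100, e1101, e1110, e0100,
    e0111, e1000] at r1 r2 r3 r4
  have q0 : d 0 0 0 0 = d 0 1 1 0 + d 0 1 0 1 := by
    linear_combination (25 / 12 : ℂ) * r4
  have q1 : d 1 0 0 1 = d 0 1 1 0 := by
    linear_combination (-25 / 12 : ℂ) * r1 + q0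
  have q2 : d 1 0 1 0 = d 0 1 0 1 := by
    linear_combination (-25 / 12 : ℂ) * r2 + q0
  have q3 : d 1 1 1 1 = d 0 1 1 0 + d 0 1 0 1 := by
    linear_combination (-25 / 12 : ℂ) * r3 + q1
  fin_cases j <;> fin_cases l <;> fin_cases l' <;> fin_cases j' <;>
    simp [e0001, e0010, e0011, e1100, e1101, e1110, e0100, e0111, e1000, e1011, q0, q1, q2, q3]

/-- The components of the quaternion units, and the dual family. -/
def unitMatrix : Matrix (Fin 2 × Fin 2) (Fin 4) ℂ :=
  Matrix.of fun κ m => quatUnit m κ.1 κ.2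

/-- The inverse of `unitMatrix`. -/
def unitMatrixInv : Matrix (Fin 4) (Fin 2 × Fin 2) ℂ :=
  Matrix.of fun m κ => 1 / 2 * star (quatUnit m κ.1 κ.2)

theorem unitMatrixInv_mul : unitMatrixInv * unitMatrix = 1 := by
  have hI : Complex.I * Complex.I = -1 := Complex.I_mul_I
  ext m n
  fin_cases m <;> fin_cases n <;>
    simp [unitMatrix, unitMatrixInv, Matrix.mul_apply, Fintype.sum_prod_type, Fin.sum_univ_two,
      quatUnit, mul_assoc, hI] <;> norm_num

theorem sum_unitMatrixInv_smul_quat {A : Type u} [Ring A] [Algebra ℂ A] (x : Fin 4 → A)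
    (m : Fin 4) : ∑ τ, unitMatrixInv m τ • quat x τ.1 τ.2 = x m := by
  have h : ∀ n, ∑ τ, unitMatrixInv m τ * unitMatrix τ n = (1 : Matrix (Fin 4) (Fin 4) ℂ) m n :=
    fun n => by rw [← unitMatrixInv_mul, Matrix.mul_apply]
  simp only [quat_apply, Finset.smul_sum, smul_smul]
  rw [Finset.sum_comm]
  simp only [← Finset.sum_smul]
  calc ∑ n, (∑ τ, unitMatrixInv m τ * unitMatrix τ n) • x n = x m := by
        simp [h, Matrix.one_apply]

/-- The commutation matrix of the `x₁^l` with `x₂^a`, in terms of the quaternion entries. -/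
def quatLeft (R : DefTensor) (a b : Fin 4) : Matrix (Fin 2 × Fin 2) (Fin 2 × Fin 2) ℂ :=
  unitMatrix * (Matrix.of fun l m => R l a b m) * unitMatrixInv

/-- The commutation matrices of the quaternion entries of `x₁` with those of `x₂`. -/
def quatR (R : DefTensor) (κ' τ' : Fin 2 × Fin 2) : Matrix (Fin 2 × Fin 2) (Fin 2 × Fin 2) ℂ :=
  ∑ a, ∑ b, (quatUnit a κ'.1 κ'.2 * unitMatrixInv b τ') • quatLeft R a b

theorem quat_mul_quat (R : DefTensor) (κ κ' : Fin 2 × Fin 2) :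
    quat (S7.x₁ R) κ.1 κ.2 * quat (S7.x₂ R) κ'.1 κ'.2 =
      ∑ τ', ∑ τ, quatR R κ' τ' κ τ • (quat (S7.x₂ R) τ'.1 τ'.2 * quat (S7.x₁ R) τ.1 τ.2) := by
  have h1 : ∀ a, quat (S7.x₁ R) κ.1 κ.2 * S7.x₂ R a =
      ∑ b, ∑ τ, quatLeft R a b κ τ • (S7.x₂ R b * quat (S7.x₁ R) τ.1 τ.2) := by
    intro a
    have h2 : ∀ b, ∑ τ, quatLeft R a b κ τ • (S7.x₂ R b * quat (S7.x₁ R) τ.1 τ.2) =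
        ∑ m, ∑ l, (unitMatrix κ l * R l a b m) • (S7.x₂ R b * S7.x₁ R m) := by
      intro b
      have hq : ∀ τ, quatLeft R a b κ τ =
          ∑ m, (unitMatrix * Matrix.of fun l m => R l a b m) κ m * unitMatrixInv m τ :=
        fun τ => Matrix.mul_apply
      simp only [hq, Finset.sum_smul]
      rw [Finset.sum_comm]
      refine Finset.sum_congr rfl fun m _ => ?_
      simp only [mul_smul, ← Finset.smul_sum, ← mul_smul_comm, ← Finset.mul_sum,
        sum_unitMatrixInv_smul_quat]
      rw [Matrix.mul_apply, Finset.sum_smul]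
      simp only [Matrix.of_apply, mul_smul]
    rw [Finset.sum_congr rfl fun b _ => h2 b, quat_apply, Finset.sum_mul]
    simp only [smul_mul_assoc, S7.x₁_mul_x₂, Finset.smul_sum, smul_smul]
    exact (sum_rotate _).trans (Finset.sum_congr rfl fun b _ => rfl)
  have h3 : ∀ (b : Fin 4) (τ : Fin 2 × Fin 2), S7.x₂ R b * quat (S7.x₁ R) τ.1 τ.2 =
      ∑ τ', unitMatrixInv b τ' • (quat (S7.x₂ R) τ'.1 τ'.2 * quat (S7.x₁ R) τ.1 τ.2) := by
    intro b τ
    rw [← sum_unitMatrixInv_smul_quat (S7.x₂ R) b, Finset.sum_mul]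
    simp only [smul_mul_assoc]
  rw [quat_apply (S7.x₂ R) κ'.1, Finset.mul_sum]
  simp only [mul_smul_comm, h1, h3, quatR, Matrix.sum_apply, Matrix.smul_apply, Finset.sum_smul,
    Finset.smul_sum, smul_smul]
  refine Eq.trans ?_ ((Finset.sum_congr rfl fun τ' _ => sum_rotate _).trans (sum_rotate _)).symm
  refine Finset.sum_congr rfl fun a _ => Finset.sum_congr rfl fun b _ => ?_
  rw [Finset.sum_comm]
  refine Finset.sum_congr rfl fun τ' _ => Finset.sum_congr rfl fun τ _ => ?_
  congr 1
  rw [smul_eq_mul]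
  ring

/-- Each `quatR` is a combination of the commuting matrices of `comm_upper`, conjugated by the
change to quaternion entries. -/
theorem quatR_commute {R : DefTensor} (hR : IsDeformation R) (κ τ κ' τ' : Fin 2 × Fin 2) :
    quatR R κ τ * quatR R κ' τ' = quatR R κ' τ' * quatR R κ τ := by
  have h : ∀ a b a' b', Commute (quatLeft R a b) (quatLeft R a' b') := by
    intro a b a' b'
    have key : ∀ M N : Matrix (Fin 4) (Fin 4) ℂ,
        unitMatrix * M * unitMatrixInv * (unitMatrix * N * unitMatrixInv) =
          unitMatrix * (M * N) * unitMatrixInv := by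
      intro M N
      have e : unitMatrix * M * unitMatrixInv * (unitMatrix * N * unitMatrixInv) =
        unitMatrix * M * (unitMatrixInv * unitMatrix) * N * unitMatrixInv := by
        simp only [Matrix.mul_assoc]
      rw [e, unitMatrixInv_mul, Matrix.mul_one, Matrix.mul_assoc unitMatrix]
    rw [Commute, SemiconjBy, quatLeft, quatLeft, key, key]
    congr 2
    ext l n
    simp only [Matrix.mul_apply, Matrix.of_apply]
    exact hR.comm_upper l a b a' b' n
  exact Commute.sum_left _ _ _ fun a _ => Commute.sum_left _ _ _ fun b _ =>
    Commute.sum_right _ _ _ fun a' _ => Commute.sum_right _ _ _ fun b' _ =>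
      ((h a b a' b').smul_left _).smul_right _

end

/-! ### `SU(2)`-symmetry: splitting the commutation matrices into identity and flip parts. -/

section

open Hochschild

variable {R : DefTensor}

/-- Apply the automorphism to `quat_mul_quat` and read off coefficients with the functional dual to
one product of an entry of `x₂` with an entry of `x₁`. -/
theorem quatR_invariant (hR : IsDeformation R) (hS : SU2Acts R) {w : Matrix (Fin 2) (Fin 2) ℂ}
    (hw : w ∈ Matrix.specialUnitaryGroup (Fin 2) ℂ) (k k' i i' j l l' j' : Fin 2) :
    ∑ j₁, ∑ l₁, w j₁ j * w l₁ l * quatR R (k, l₁) (k', l') (i, j₁) (i', j') =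
      ∑ l₂, ∑ j₂, quatR R (k, l) (k', l₂) (i, j) (i', j₂) * (w l' l₂ * w j' j₂) := by
  obtain ⟨α, hα⟩ := hS w hw
  have h2 : ∀ k l, α (quat (S7.x₂ R) k l) = ∑ l₁, w l₁ l • quat (S7.x₂ R) k l₁ := by
    intro k l
    have h := congrFun (congrFun hα (Sum.inl k)) l
    simp only [ket, Matrix.map_apply, Matrix.fromRows_apply_inl, Matrix.mul_apply] at h
    rw [h]
    exact Finset.sum_congr rfl fun l₁ _ => by rw [Algebra.smul_def, Algebra.commutes]
  have h1 : ∀ i j, α (quat (S7.x₁ R) i j) = ∑ j₁, w j₁ j • quat (S7.x₁ R) i j₁ := by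
    intro k l
    have h := congrFun (congrFun hα (Sum.inr k)) l
    simp only [ket, Matrix.map_apply, Matrix.fromRows_apply_inr, Matrix.mul_apply] at h
    rw [h]
    exact Finset.sum_congr rfl fun l₁ _ => by rw [Algebra.smul_def, Algebra.commutes]
  obtain ⟨f, -, -, hf⟩ := hR.exists_functional fun p q r s =>
    if p = k' then if q = l' then if r = i' then if s = j' then 1 else 0 else 0 else 0 else 0
  have e := congrArg (fun u => f (α u)) (quat_mul_quat R (i, j) (k, l))
  simp only [map_mul, map_sum, map_smul, h1, h2, Finset.sum_mul, Finset.mul_sum,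
    smul_mul_smul_comm] at e
  have hq : ∀ j₁ l₁, f (quat (S7.x₁ R) i j₁ * quat (S7.x₂ R) k l₁) =
      quatR R (k, l₁) (k', l') (i, j₁) (i', j') := by
    intro j₁ l₁
    have := congrArg f (quat_mul_quat R (i, j₁) (k, l₁))
    simp only [map_sum, map_smul, hf, Fintype.sum_prod_type] at this
    rw [this]
    simp
  simp only [hq, hf, Fintype.sum_prod_type] at e
  simp only [Fin.sum_univ_two] at e ⊢
  fin_cases k' <;> fin_cases l' <;> fin_cases i' <;> fin_cases j' <;>
    simp only [Fin.zero_eta, Fin.mk_one, Fin.isValue, zero_ne_one, one_ne_zero, if_true, if_false,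
      smul_eq_mul, mul_zero, mul_one, add_zero, zero_add] at e ⊢ <;>
    linear_combination e

/-- Coefficient of the identity in the commutation matrix. -/
def partId (R : DefTensor) (k k' : Fin 2) : Matrix (Fin 2) (Fin 2) ℂ :=
  Matrix.of fun i i' => quatR R (k, 1) (k', 1) (i, 0) (i', 0)

/-- Coefficient of the flip in the commutation matrix. -/
def partFlip (R : DefTensor) (k k' : Fin 2) : Matrix (Fin 2) (Fin 2) ℂ :=
  Matrix.of fun i i' => quatR R (k, 1) (k', 0) (i, 0) (i', 1)

theorem quatR_eq (hR : IsDeformation R) (hS : SU2Acts R) (k l k' l' i j i' j' : Fin 2) :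
    quatR R (k, l) (k', l') (i, j) (i', j') =
      (if j = j' ∧ l = l' then partId R k k' i i' else 0) +
      if j = l' ∧ l = j' then partFlip R k k' i i' else 0 :=
  invariant_tensor (d := fun j l l' j' => quatR R (k, l) (k', l') (i, j) (i', j'))
    (fun _ hw j l l' j' => quatR_invariant hR hS hw k k' i i' j l l' j') j l l' j'

/-- In the `SU(2)` index `quatR` is `partId ⊗ 1` (for `l = l'`) plus `partFlip ⊗ E`, with `E` the
matrix unit at `(l', l)`. As the `quatR` commute while matrix units do not, comparing entries forces
products of flip parts to vanish and the other products to commute. -/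
theorem part_relations (hR : IsDeformation R) (hS : SU2Acts R) (k k' m m' : Fin 2) :
    partFlip R k k' * partFlip R m m' = 0 ∧
    partId R k k' * partFlip R m m' = partFlip R m m' * partId R k k' ∧
    partId R k k' * partId R m m' = partId R m m' * partId R k k' := by
  have hc : ∀ l l' n n' i j i' j', ∑ a, ∑ b, quatR R (k, l) (k', l') (i, j) (a, b) *
      quatR R (m, n) (m', n') (a, b) (i', j') = ∑ a, ∑ b, quatR R (m, n) (m', n') (i, j) (a, b) *
      quatR R (k, l) (k', l') (a, b) (i', j') := by
    intro l l' n n' i j i' j'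
    have h := congrFun (congrFun (quatR_commute hR (k, l) (k', l') (m, n) (m', n')) (i, j)) (i', j')
    simpa only [Matrix.mul_apply, Fintype.sum_prod_type] using h
  simp only [quatR_eq hR hS] at hc
  have hFF : partFlip R k k' * partFlip R m m' = 0 := by
    ext i i'
    have h := hc 0 1 1 0 i 1 i' 1
    simpa [Fin.sum_univ_two, Matrix.mul_apply] using h
  have hFF' : partFlip R m m' * partFlip R k k' = 0 := by
    ext i i'
    have h := hc 1 0 0 1 i 1 i' 1
    simpa [Fin.sum_univ_two, Matrix.mul_apply] using h.symm
  have hIF : partId R k k' * partFlip R m m' = partFlip R m m' * partId R k k' := by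
    ext i i'
    have h := hc 0 0 0 1 i 1 i' 0
    have h0 := congrFun (congrFun hFF' i) i'
    simp [Fin.sum_univ_two, Matrix.mul_apply] at h h0 ⊢
    linear_combination h + h0
  have hII : partId R k k' * partId R m m' = partId R m m' * partId R k k' := by
    ext i i'
    have h := hc 0 0 0 0 i 1 i' 1
    simpa [Fin.sum_univ_two, Matrix.mul_apply] using h
  exact ⟨hFF, hIF, hII⟩

/-- The matrices by which `Y*` is expressed in terms of `Y`. -/
def starMatrix (R : DefTensor) (k k' : Fin 2) : Matrix (Fin 2) (Fin 2) ℂ :=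
  partId R k k' - partFlip R k k'

theorem starMatrix_comm (hR : IsDeformation R) (hS : SU2Acts R) (k k' m m' : Fin 2) :
    starMatrix R k k' * starMatrix R m m' = starMatrix R m m' * starMatrix R k k' := by
  obtain ⟨h1, h2, h3⟩ := part_relations hR hS k k' m m'
  obtain ⟨h1', h2', -⟩ := part_relations hR hS m m' k k'
  rw [starMatrix, starMatrix, sub_mul, mul_sub, mul_sub, sub_mul, mul_sub, mul_sub, h1, h1', h2, h3,
    h2']
  abel

end

section

open Hochschild

/-! ### Nondegeneracy of the volume forms -/

/-- Commuting `2 × 2` matrices have a common left eigenvector. -/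
theorem exists_common_left_eigenvector {κ : Type u} (S : κ → Matrix (Fin 2) (Fin 2) ℂ)
    (hS : ∀ s t, S s * S t = S t * S s) :
    ∃ c : Fin 2 → ℂ, c ≠ 0 ∧ ∀ s, ∃ n : ℂ, Matrix.vecMul c (S s) = n • c := by
  by_cases hsc : ∀ s, ∃ n : ℂ, S s = n • (1 : Matrix (Fin 2) (Fin 2) ℂ)
  · refine ⟨![1, 0], fun h => by simpa using congrFun h 0, fun s => ?_⟩
    obtain ⟨n, hn⟩ := hsc s
    exact ⟨n, by rw [hn, Matrix.vecMul_smul, Matrix.vecMul_one]⟩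
  · push Not at hsc
    obtain ⟨s, hs⟩ := hsc
    obtain ⟨μ, hμ⟩ := Module.End.exists_eigenvalue (K := ℂ) (Matrix.vecMulLinear (S s))
    obtain ⟨c, hc⟩ := hμ.exists_hasEigenvector
    have hc1 : Matrix.vecMul c (S s) = μ • c := hc.apply_eq_smul
    have hc0 : c ≠ 0 := hc.2
    refine ⟨c, hc0, fun t => ?_⟩
    set v := Matrix.vecMul c (S t) with hv
    have hv1 : Matrix.vecMul v (S s) = μ • v := by
      rw [hv, Matrix.vecMul_vecMul, hS, ← Matrix.vecMul_vecMul, hc1, Matrix.smul_vecMul]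
    -- Otherwise `c` and `v` would be a basis of eigenvectors for `μ`, and `S s` would be scalar. So
    -- the eigenspace is the line of `c`, preserved by every commuting matrix.
    have hprop : c 0 * v 1 = c 1 * v 0 := by
      by_contra hne
      refine hs μ ?_
      have e1 := fun j => congrFun hc1 j
      have e2 := fun j => congrFun hv1 j
      simp only [Matrix.vecMul, dotProduct, Fin.sum_univ_two, Pi.smul_apply, smul_eq_mul] at e1 e2
      have hne' : c 0 * v 1 - c 1 * v 0 ≠ 0 := sub_ne_zero.2 hne
      ext i j
      fin_cases i <;> fin_cases j <;> simp <;> refine mul_left_cancel₀ hne' ?_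
      · linear_combination v 1 * e1 0 - c 1 * e2 0
      · linear_combination v 1 * e1 1 - c 1 * e2 1
      · linear_combination -v 0 * e1 0 + c 0 * e2 0
      · linear_combination -v 0 * e1 1 + c 0 * e2 1
    by_cases h0 : c 0 = 0
    · have h1 : c 1 ≠ 0 := fun h1 => hc0 (by funext k; fin_cases k <;> simp [h0, h1])
      refine ⟨v 1 / c 1, ?_⟩
      funext k
      fin_cases k
      · rw [h0, zero_mul] at hprop
        simpa [h0] using (mul_eq_zero.1 hprop.symm).resolve_left h1
      · simp [h1]
    · refine ⟨v 0 / c 0, ?_⟩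
      funext k
      fin_cases k
      · simp [h0]
      · simp only [Fin.mk_one, Pi.smul_apply, smul_eq_mul]
        field_simp
        linear_combination hprop

/-- The orientation argument: the trace identities expressing the vanishing of the volume form
are incompatible with a common kernel. -/
theorem trace_identities_contradiction
    {lam : Matrix (Fin 2) (Fin 2) ℂ →ₗ[ℂ] Matrix (Fin 2) (Fin 2) ℂ}
    (hsurj : Function.Surjective lam)
    (h₁ : ∀ a b, (a * lam b).trace = (lam a * b).trace)
    (h₃ : ∀ a b c d, (a * (lam b * (c * lam d))).trace = (lam a * (b * (lam c * d))).trace)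
    {c : Fin 2 → ℂ} (hc : c ≠ 0)
    (hker : ∀ M, Matrix.vecMul c (lam (M * !![c 0, c 1; 0, 0])) = 0) : False := by
  -- Nondegeneracy of the trace form: pair with `x`, apply `h₃`, and return `lam` to the other
  -- factor by `h₁`.
  have key : ∀ a b d, lam a * (b * lam d) = lam (a * lam b * d) := by
    intro a b d
    refine Matrix.ext_iff_trace_mul_left.2 fun x => ?_
    rw [h₃, h₁, Matrix.mul_assoc]
  have hinj : Function.Injective lam := LinearMap.injective_iff_surjective.2 hsurj
  set d : Matrix (Fin 2) (Fin 2) ℂ := !![c 0, c 1; 0, 0] with hd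
  -- With `lam u = 1`, `key` puts `M * lam d` in the image under `lam` of left multiples of `d`,
  -- which `c` annihilates.
  obtain ⟨u, hu⟩ := hsurj 1
  have hrow : ∀ M, Matrix.vecMul (Matrix.vecMul c M) (lam d) = 0 := by
    intro M
    have := key u M d
    rw [hu, Matrix.one_mul] at this
    rw [Matrix.vecMul_vecMul, this, hker]
  obtain ⟨i, hi⟩ := Function.ne_iff.1 hc
  have hd0 : lam d = 0 := by
    ext j k
    have h := congrFun (hrow (Matrix.single i j (c i)⁻¹)) k
    have e : Matrix.vecMul c (Matrix.single i j (c i)⁻¹) = Pi.single j 1 := by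
      funext m
      have hi' : c i ≠ 0 := hi
      by_cases hm : m = j
      · subst hm
        simp [Matrix.vecMul, dotProduct, Matrix.single_apply, hi']
      · simp [Matrix.vecMul, dotProduct, hm, Ne.symm hm]
    rw [e, Matrix.single_one_vecMul] at h
    exact h
  have hd1 : d = 0 := hinj (by rw [hd0, map_zero])
  refine hc (funext fun k => ?_)
  have e0 := congrFun (congrFun hd1 0) 0
  have e1 := congrFun (congrFun hd1 0) 1
  fin_cases k
  · simpa [hd] using e0
  · simpa [hd] using e1

variable (R : DefTensor)

/-- The linear map expressing the entries of `Y*` in terms of those of `Y`. -/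
def starMap : Matrix (Fin 2) (Fin 2) ℂ →ₗ[ℂ] Matrix (Fin 2) (Fin 2) ℂ where
  toFun b := Matrix.of fun i j =>
    ![∑ k, (starMatrix R 1 k i 0 * b k 1 - starMatrix R 1 k i 1 * b k 0),
      -∑ k, (starMatrix R 0 k i 0 * b k 1 - starMatrix R 0 k i 1 * b k 0)] j
  map_add' a b := by
    ext i j
    fin_cases j <;> simp [Fin.sum_univ_two] <;> ring
  map_smul' c b := by
    ext i j
    fin_cases j <;> simp [Fin.sum_univ_two] <;> ring

/-- For a common left eigenvector `c`, contracting `starMap R b` with `c` leaves combinations of `c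
0 * b k 1 - c 1 * b k 0`. These vanish when every row of `b` is a multiple of `c`, as for `b = M *
d`. For commuting coordinates `starMap` is the adjugate and this is the singularity of `d`. -/
theorem exists_starMap_kernel {R : DefTensor} (hR : IsDeformation R) (hS : SU2Acts R) :
    ∃ c : Fin 2 → ℂ, c ≠ 0 ∧
      ∀ M, Matrix.vecMul c (starMap R (M * !![c 0, c 1; 0, 0])) = 0 := by
  obtain ⟨c, hc, h⟩ := exists_common_left_eigenvector
    (fun p : Fin 2 × Fin 2 => starMatrix R p.1 p.2)
    (fun p q => starMatrix_comm hR hS p.1 p.2 q.1 q.2)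
  refine ⟨c, hc, fun M => ?_⟩
  choose n hn using h
  have e : ∀ k k' i', c 0 * starMatrix R k k' 0 i' + c 1 * starMatrix R k k' 1 i' =
      n (k, k') * c i' := by
    intro k k' i'
    have := congrFun (hn (k, k')) i'
    simpa [Matrix.vecMul, dotProduct, Fin.sum_univ_two] using this
  funext j
  fin_cases j
  · simp [Matrix.vecMul, dotProduct, Fin.sum_univ_two, starMap, Matrix.mul_apply]
    linear_combination M 0 0 * c 1 * e 1 0 0 - M 0 0 * c 0 * e 1 0 1 +
      M 1 0 * c 1 * e 1 1 0 - M 1 0 * c 0 * e 1 1 1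
  · simp [Matrix.vecMul, dotProduct, Fin.sum_univ_two, starMap, Matrix.mul_apply]
    linear_combination -M 0 0 * c 1 * e 0 0 0 + M 0 0 * c 0 * e 0 0 1 -
      M 1 0 * c 1 * e 0 1 0 + M 1 0 * c 0 * e 0 1 1

section Entries

theorem Y7_zero (k : Fin 2) : quat (Y7 R) k 0 =
    (2 : ℂ) • (quat (S7.x₂ R) k 0 * quat (S7.x₁ R) 1 1 -
      quat (S7.x₂ R) k 1 * quat (S7.x₁ R) 1 0) := by
  rw [quat_Y7, quat_conjTranspose (S7.star_x₁ R)]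
  simp [Matrix.mul_apply, Fin.sum_univ_two, sub_eq_add_neg]

theorem Y7_one (k : Fin 2) : quat (Y7 R) k 1 =
    (2 : ℂ) • (quat (S7.x₂ R) k 1 * quat (S7.x₁ R) 0 0 -
      quat (S7.x₂ R) k 0 * quat (S7.x₁ R) 0 1) := by
  rw [quat_Y7, quat_conjTranspose (S7.star_x₁ R)]
  simp [Matrix.mul_apply, Fin.sum_univ_two, sub_eq_add_neg, add_comm]

theorem Y7_conjTranspose : (quat (Y7 R)).conjTranspose =
    (2 : ℂ) • (quat (S7.x₁ R) * (quat (S7.x₂ R)).conjTranspose) := by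
  rw [quat_Y7, Matrix.conjTranspose_smul, Matrix.conjTranspose_mul,
    Matrix.conjTranspose_conjTranspose]
  simp

theorem Y7_conjTranspose_zero (i : Fin 2) : (quat (Y7 R)).conjTranspose i 0 =
    (2 : ℂ) • (quat (S7.x₁ R) i 0 * quat (S7.x₂ R) 1 1 -
      quat (S7.x₁ R) i 1 * quat (S7.x₂ R) 1 0) := by
  rw [Y7_conjTranspose, quat_conjTranspose (S7.star_x₂ R)]
  simp [Matrix.mul_apply, Fin.sum_univ_two, sub_eq_add_neg]

theorem Y7_conjTranspose_one (i : Fin 2) : (quat (Y7 R)).conjTranspose i 1 =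
    -((2 : ℂ) • (quat (S7.x₁ R) i 0 * quat (S7.x₂ R) 0 1 -
      quat (S7.x₁ R) i 1 * quat (S7.x₂ R) 0 0)) := by
  rw [Y7_conjTranspose, quat_conjTranspose (S7.star_x₂ R)]
  simp [Matrix.mul_apply, Fin.sum_univ_two, sub_eq_add_neg, add_comm]

end Entries

variable {R : DefTensor}

/-- On the skew combination in the `SU(2)` index the flip acts as `-1`, whence `partId - partFlip`.
The entries of `Y` and `Y*` are such skew combinations up to scalars. -/
theorem quat_skew_mul (hR : IsDeformation R) (hS : SU2Acts R) (i k : Fin 2) :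
    quat (S7.x₁ R) i 0 * quat (S7.x₂ R) k 1 - quat (S7.x₁ R) i 1 * quat (S7.x₂ R) k 0 =
      ∑ k', ∑ i', starMatrix R k k' i i' •
        (quat (S7.x₂ R) k' 1 * quat (S7.x₁ R) i' 0 - quat (S7.x₂ R) k' 0 * quat (S7.x₁ R) i' 1) := by
  have h1 := quat_mul_quat R (i, 0) (k, 1)
  have h2 := quat_mul_quat R (i, 1) (k, 0)
  simp only [Fintype.sum_prod_type, quatR_eq hR hS, Fin.sum_univ_two] at h1 h2
  rw [h1, h2]
  simp [Fin.sum_univ_two, starMatrix]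
  module

theorem map_conjTranspose_Y7 (hR : IsDeformation R) (hS : SU2Acts R) (f : S7 R →ₗ[ℂ] ℂ) :
    (quat (Y7 R)).conjTranspose.map f = starMap R ((quat (Y7 R)).map f) := by
  ext i j
  fin_cases j
  · simp only [Matrix.map_apply, Fin.zero_eta, Y7_conjTranspose_zero, quat_skew_mul hR hS,
      starMap, LinearMap.coe_mk, AddHom.coe_mk, Matrix.of_apply, Matrix.cons_val_zero, Y7_zero,
      Y7_one, map_smul, map_add, map_sub, smul_eq_mul, Fin.sum_univ_two]
    ring
  · simp only [Matrix.map_apply, Fin.mk_one, Y7_conjTranspose_one, quat_skew_mul hR hS,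
      starMap, LinearMap.coe_mk, AddHom.coe_mk, Matrix.of_apply, Matrix.cons_val_one, Y7_zero,
      Y7_one, map_smul, map_add, map_sub, map_neg, smul_eq_mul, Fin.sum_univ_two,
      Matrix.cons_val_fin_one]
    ring

theorem exists_functional_Y7 (hR : IsDeformation R) (b : Matrix (Fin 2) (Fin 2) ℂ) :
    ∃ f : S7 R →ₗ[ℂ] ℂ, f 1 = 0 ∧ (∀ u, f (Y74 R * u) = 0) ∧ (quat (Y7 R)).map f = b := by
  -- Each entry of `Y` is twice a difference of two products; one product carries half the wanted
  -- value and the other is sent to `0`.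
  obtain ⟨f, h1, h2, h3⟩ := hR.exists_functional fun k =>
    ![![![0, 0], ![0, b k 0 / 2]], ![![b k 1 / 2, 0], ![0, 0]]]
  refine ⟨f, h1, h2, ?_⟩
  ext k j
  fin_cases j
  · simp [Y7_zero, h3]
    ring
  · simp [Y7_one, h3]
    ring

/-- Conjugating by the involution a functional that prescribes `Y` gives one that prescribes `Y*`,
and its values on `Y*` are `starMap R` of its values on `Y`. -/
theorem starMap_surjective (hR : IsDeformation R) (hS : SU2Acts R) :
    Function.Surjective (starMap R) := by
  intro d
  obtain ⟨f, -, -, h⟩ := exists_functional_Y7 hR d.conjTranspose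
  let g : S7 R →ₗ[ℂ] ℂ :=
    { toFun := fun s => star (f (star s))
      map_add' := fun s t => by simp
      map_smul' := fun c s => by simp }
  refine ⟨(quat (Y7 R)).map g, ?_⟩
  rw [← map_conjTranspose_Y7 hR hS]
  ext i j
  have := congrFun (congrFun h j) i
  simp only [Matrix.map_apply, Matrix.conjTranspose_apply] at this ⊢
  change star (f (star (star _))) = _
  rw [star_star, this, star_star]

end

/-! ### Vanishing of the lower components and nonvanishing of the volume forms. -/

section

open Hochschild

variable {R : DefTensor}

theorem S4.Y_map (f : S7 R →ₗ[ℂ] ℂ) :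
    (S4.Y R).map (f ∘ₗ (S4 R).subtype.toAlgHom.toLinearMap) = (quat (Y7 R)).map f := by
  rw [← S4.Y_map_val]
  rfl

theorem S4.Y_conjTranspose_map (f : S7 R →ₗ[ℂ] ℂ) :
    (S4.Y R).conjTranspose.map (f ∘ₗ (S4 R).subtype.toAlgHom.toLinearMap) =
      (quat (Y7 R)).conjTranspose.map f := by
  rw [← S4.Y_map_val]
  rfl

theorem traceTensor_Y_eq (h : chOdd 0 (S4.Y R) = 0) :
    traceTensor (![S4.Y R, (S4.Y R).conjTranspose] : Fin 2 → Matrix (Fin 2) (Fin 2) (S4 R)) =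
      traceTensor ![(S4.Y R).conjTranspose, S4.Y R] := by
  rw [chOdd_zero_eq] at h
  exact sub_eq_zero.1 h

theorem chEven_one_proj (h : chOdd 0 (S4.Y R) = 0) : chEven 1 (S4.proj R) = 0 := by
  rw [chEven_eq, S4.two_proj_sub_one]
  exact (congrArg _ (traceTensor_reflMatrix_eq_zero _ _ _ (traceTensor_Y_eq h))).trans (smul_zero _)

theorem isCycle_chEven_two_proj (h : chOdd 0 (S4.Y R) = 0) : IsCycle (chEven 2 (S4.proj R)) := by
  rw [chEven_eq, S4.two_proj_sub_one]
  refine (map_smul (nbdry (S4 R) 3) _ _).trans ?_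
  exact (congrArg _ (nbdry_traceTensor_const (S4.reflMatrix_sq R)
    (traceTensor_reflMatrix_eq_zero _ _ _ (traceTensor_Y_eq h)))).trans (smul_zero _)

theorem S3.traceTensor_Y_eq (h : chOdd 0 (S4.Y R) = 0) :
    traceTensor (![S3.Y R, (S3.Y R).conjTranspose] : Fin 2 → Matrix (Fin 2) (Fin 2) (S3 R)) =
      traceTensor ![(S3.Y R).conjTranspose, S3.Y R] := by
  have e := congrArg (nmap (S3.mk R) 1) (NCSpheres.traceTensor_Y_eq h)
  rw [nmap_traceTensor, nmap_traceTensor, vec_two_eq (fun k : Fin 2 => _),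
    vec_two_eq (fun k : Fin 2 => Matrix.map (![(S4.Y R).conjTranspose, S4.Y R] k) _)] at e
  rw [S3.Y_conjTranspose]
  exact e

theorem chOdd_zero_S3 (h : chOdd 0 (S4.Y R) = 0) : chOdd 0 (S3.Y R) = 0 := by
  rw [chOdd_zero_eq]
  exact sub_eq_zero.2 (S3.traceTensor_Y_eq h)

theorem isCycle_chOdd_one_S3 (h : chOdd 0 (S4.Y R) = 0) : IsCycle (chOdd 1 (S3.Y R)) := by
  rw [chOdd_one_eq]
  exact nbdry_traceTensor_alternating (S3.Y_unitary R).1 (S3.Y_unitary R).2 (S3.traceTensor_Y_eq h)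

/-- The vanishing of `ch_{1/2}(Y)`, evaluated on two functionals that take the values `a` and `b` on
`Y`. -/
theorem starMap_trace (hR : IsDeformation R) (hS : SU2Acts R) (h : chOdd 0 (S4.Y R) = 0)
    (a b : Matrix (Fin 2) (Fin 2) ℂ) : (a * starMap R b).trace = (starMap R a * b).trace := by
  obtain ⟨f, hf, -, hfa⟩ := exists_functional_Y7 hR a
  obtain ⟨g, hg, -, hgb⟩ := exists_functional_Y7 hR b
  have e := congrArg (evalFun (A := S4 R) ![f ∘ₗ (S4 R).subtype.toAlgHom.toLinearMap,
    g ∘ₗ (S4 R).subtype.toAlgHom.toLinearMap] (by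
      intro k hk
      fin_cases k
      · exact absurd rfl hk
      · exact hg)) (traceTensor_Y_eq h)
  rw [evalFun_traceTensor_one, evalFun_traceTensor_one] at e
  simp only [Matrix.cons_val_zero, Matrix.cons_val_one, S4.Y_map, S4.Y_conjTranspose_map,
    map_conjTranspose_Y7 hR hS, hfa, hgb] at e
  exact e

/-- Functionals on the three-sphere with prescribed values on the entries of `Y`. -/
theorem S3.exists_functional_Y (hR : IsDeformation R) (hS : SU2Acts R)
    (b : Matrix (Fin 2) (Fin 2) ℂ) : ∃ f : S3 R →ₗ[ℂ] ℂ, f 1 = 0 ∧ (S3.Y R).map f = b ∧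
      (S3.Y R).conjTranspose.map f = starMap R b := by
  obtain ⟨f, h1, h2, h3⟩ := exists_functional_Y7 hR b
  obtain ⟨g, hg⟩ : ∃ g : S3 R →ₗ[ℂ] ℂ, ∀ x : S4 R, g (S3.mk R x) = f x :=
    ringQuot_exists_factor (S4.EquatorRel R) (f ∘ₗ (S4 R).subtype.toAlgHom.toLinearMap) (by
      rintro _ _ ⟨rfl, rfl⟩ u v
      change f ((u : S7 R) * Y74 R * v) = f ((u : S7 R) * 0 * v)
      -- Since `Y⁴` is central, killing its multiples `Y⁴ u` suffices to kill the ideal it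
      -- generates.
      rw [← hR.Y74_comm, mul_assoc, h2, mul_zero, zero_mul, map_zero])
  refine ⟨g, ?_, ?_, ?_⟩
  · rw [← map_one (S3.mk R), hg]
    exact h1
  · rw [← h3, ← S4.Y_map]
    ext i j
    exact hg _
  · rw [← h3, ← map_conjTranspose_Y7 hR hS, ← S4.Y_conjTranspose_map, S3.Y_conjTranspose]
    ext i j
    exact hg _

theorem chOdd_one_S3_ne_zero (hR : IsDeformation R) (hS : SU2Acts R) (h : chOdd 0 (S4.Y R) = 0) :
    chOdd 1 (S3.Y R) ≠ 0 := by
  intro h0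
  obtain ⟨c, hc, hker⟩ := exists_starMap_kernel hR hS
  refine trace_identities_contradiction (starMap_surjective hR hS) (starMap_trace hR hS h) ?_ hc hker
  intro a b c d
  obtain ⟨fa, -, ha, ha'⟩ := S3.exists_functional_Y hR hS a
  obtain ⟨fb, hb1, hb, hb'⟩ := S3.exists_functional_Y hR hS b
  obtain ⟨fc, hc1, hc, hc'⟩ := S3.exists_functional_Y hR hS c
  obtain ⟨fd, hd1, hd, hd'⟩ := S3.exists_functional_Y hR hS d
  rw [chOdd_one_eq] at h0
  have e := congrArg (evalFun (A := S3 R) ![fa, fb, fc, fd] (by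
      intro k hk
      fin_cases k
      · exact absurd rfl hk
      · exact hb1
      · exact hc1
      · exact hd1)) (sub_eq_zero.1 h0)
  rw [evalFun_traceTensor_three, evalFun_traceTensor_three] at e
  simp only [Fin.isValue, Matrix.cons_val, ha, hb, hc, hd, ha', hb', hc', hd'] at e
  exact e

theorem reflMatrix_map {A : Type u} [Ring A] [Algebra ℂ A] (y : A)
    (Y Y' : Matrix (Fin 2) (Fin 2) A) (f : A →ₗ[ℂ] ℂ) :
    (reflMatrix y Y Y').map f = reflMatrix (f y) (Y.map f) (Y'.map f) := by
  have hs : ∀ z : A, (Matrix.scalar (Fin 2) z).map f = Matrix.scalar (Fin 2) (f z) := by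
    intro z
    ext i j
    by_cases hij : i = j
    · subst hij; simp
    · simp [hij]
  rw [reflMatrix, Matrix.fromBlocks_map, hs, hs, map_neg, reflMatrix]

theorem trace_fromBlocks {m n : Type*} [Fintype m] [Fintype n] {A : Type*} [AddCommMonoid A]
    (P : Matrix m m A) (Q : Matrix m n A) (P' : Matrix n m A) (Q' : Matrix n n A) :
    (Matrix.fromBlocks P Q P' Q').trace = P.trace + Q'.trace := by
  simp [Matrix.trace]

theorem chEven_two_proj_ne_zero (hR : IsDeformation R) (hS : SU2Acts R)
    (h : chOdd 0 (S4.Y R) = 0) : chEven 2 (S4.proj R) ≠ 0 := by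
  intro h0
  obtain ⟨c, hc, hker⟩ := exists_starMap_kernel hR hS
  refine trace_identities_contradiction (starMap_surjective hR hS) (starMap_trace hR hS h) ?_ hc hker
  intro a b c d
  -- Evaluation at a pole: `φ` sends `Y⁴` to `1` and `Y` to `0`. It fills the zeroth slot, the only
  -- one whose functional need not kill `1`, and turns `q` into the grading `diag(1, -1)`. The four
  -- remaining slots see only off-diagonal blocks.
  obtain ⟨φ, hφ1, -, hφ2, hφ3⟩ := hR.exists_sphereEval (ξ := 0) (η := Pi.single 0 1) (by
    rw [Fin.sum_univ_four, Fin.sum_univ_four]; simp)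
  have hφY : (quat (Y7 R)).map φ = 0 := by
    have hz : ∀ (u : S7 R) i j, φ (u * quat (S7.x₁ R) i j) = 0 := by
      intro u i j
      rw [quat_apply, Finset.mul_sum, map_sum]
      exact Finset.sum_eq_zero fun m _ => by
        rw [mul_smul_comm, map_smul, hφ2, Pi.zero_apply, zero_mul, smul_zero]
    ext k j
    fin_cases j
    · simp [Y7_zero, hz]
    · simp [Y7_one, hz]
  have hφ4 : φ (Y74 R) = 1 := by
    have := hφ3 1
    rw [mul_one, hφ1, Fin.sum_univ_four, Fin.sum_univ_four] at this
    simpa using this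
  obtain ⟨fa, ha1, ha2, ha⟩ := exists_functional_Y7 hR a
  obtain ⟨fb, hb1, hb2, hb⟩ := exists_functional_Y7 hR b
  obtain ⟨fc, hc1, hc2, hc⟩ := exists_functional_Y7 hR c
  obtain ⟨fd, hd1, hd2, hd⟩ := exists_functional_Y7 hR d
  rw [chEven_eq, S4.two_proj_sub_one] at h0
  have h1 : traceTensor (fun _ : Fin 5 => reflMatrix (S4.y4 R) (S4.Y R) (S4.Y R).conjTranspose) = 0 :=
    (smul_eq_zero.1 h0).resolve_left (by norm_num)
  have e := congrArg (evalFun (A := S4 R) (fun k => (![φ, fa, fb, fc, fd] : Fin 5 → _) k ∘ₗ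
    (S4 R).subtype.toAlgHom.toLinearMap) (by
      intro k hk
      fin_cases k
      · exact absurd rfl hk
      · exact ha1
      · exact hb1
      · exact hc1
      · exact hd1)) h1
  have hy : ∀ f : S7 R →ₗ[ℂ] ℂ, (reflMatrix (S4.y4 R) (S4.Y R) (S4.Y R).conjTranspose).map
      (f ∘ₗ (S4 R).subtype.toAlgHom.toLinearMap) =
      reflMatrix (f (Y74 R)) ((quat (Y7 R)).map f) (starMap R ((quat (Y7 R)).map f)) := by
    intro f
    rw [reflMatrix_map, S4.Y_map, S4.Y_conjTranspose_map, map_conjTranspose_Y7 hR hS]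
    rfl
  have hy0 : ∀ f : S7 R →ₗ[ℂ] ℂ, (∀ u, f (Y74 R * u) = 0) → f (Y74 R) = 0 := fun f hf => by
    simpa using hf 1
  rw [evalFun_traceTensor_four, map_zero] at e
  simp only [Fin.isValue, Matrix.cons_val, hy, hφY, hφ4, hy0 fa ha2, hy0 fb hb2, hy0 fc hc2,
    hy0 fd hd2, ha, hb, hc, hd] at e
  simp only [reflMatrix, map_zero, map_neg, map_one, neg_zero, Matrix.fromBlocks_multiply,
    mul_zero, zero_mul, add_zero, zero_add, one_mul, neg_mul, trace_fromBlocks,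
    Matrix.trace_neg] at e
  linear_combination e

end

end

end NCSpheres

theorem mainTheorem3 (R : NCSpheres.DefTensor) (hR : NCSpheres.IsDeformation R) :
    -- `p = |ψ⟩⟨ψ|` is a projection, and `Y` is unitary on the three-sphere
    ((NCSpheres.ket R).conjTranspose * NCSpheres.ket R = 1 ∧
      (NCSpheres.S4.proj R).map Subtype.val =
        NCSpheres.ket R * (NCSpheres.ket R).conjTranspose ∧
      (NCSpheres.S4.proj R).conjTranspose = NCSpheres.S4.proj R ∧
      NCSpheres.S4.proj R * NCSpheres.S4.proj R = NCSpheres.S4.proj R ∧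
      NCSpheres.S3.Y R * (NCSpheres.S3.Y R).conjTranspose = 1 ∧
      (NCSpheres.S3.Y R).conjTranspose * NCSpheres.S3.Y R = 1) ∧
    NCSpheres.chEven 0 (NCSpheres.S4.proj R) = 0 ∧
    (NCSpheres.chOdd 0 (NCSpheres.S4.Y R) = 0 →
      NCSpheres.chEven 1 (NCSpheres.S4.proj R) = 0 ∧
      NCSpheres.Hochschild.IsCycle (NCSpheres.chEven 2 (NCSpheres.S4.proj R)) ∧
      NCSpheres.Hochschild.IsCycle (NCSpheres.chOdd 1 (NCSpheres.S3.Y R)) ∧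
      (NCSpheres.SU2Acts R →
        NCSpheres.chEven 2 (NCSpheres.S4.proj R) ≠ 0 ∧
        NCSpheres.chOdd 1 (NCSpheres.S3.Y R) ≠ 0 ∧
        NCSpheres.IsEvenSpherical 2 (NCSpheres.S4.proj R) ∧
        NCSpheres.IsOddSpherical 1 (NCSpheres.S3.Y R))) := by
  refine ⟨⟨NCSpheres.ket_isometry R, NCSpheres.S4.proj_map_val R, NCSpheres.S4.proj_conjTranspose R,
    NCSpheres.S4.proj_mul_self R, (NCSpheres.S3.Y_unitary R).1, (NCSpheres.S3.Y_unitary R).2⟩,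
    NCSpheres.chEven_zero_proj R, fun h => ?_⟩
  have h1 := NCSpheres.chEven_one_proj h
  have h2 := NCSpheres.isCycle_chEven_two_proj h
  have h3 := NCSpheres.isCycle_chOdd_one_S3 h
  refine ⟨h1, h2, h3, fun hS => ?_⟩
  have n2 := NCSpheres.chEven_two_proj_ne_zero hR hS h
  have n3 := NCSpheres.chOdd_one_S3_ne_zero hR hS h
  refine ⟨n2, n3, ⟨NCSpheres.S4.proj_mul_self R, NCSpheres.S4.proj_conjTranspose R, ?_, h2, n2⟩,
    ⟨(NCSpheres.S3.Y_unitary R).1, (NCSpheres.S3.Y_unitary R).2, ?_, h3, n3⟩⟩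
  · intro k hk
    interval_cases k
    · exact NCSpheres.chEven_zero_proj R
    · exact h1
  · intro k hk
    interval_cases k
    exact NCSpheres.chOdd_zero_S3 h
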